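/- Let $K\subset\mathbb R^2$ be a nonempty compact convex set whose support function $p(\varphi)=\sup\{\langle x,N(\varphi)\rangle : x\in K\}$, $N(\varphi)=(\cos\varphi,\sin\varphi)$, is of class $\mathcal C^2$ with $p+p''>0$ everywhere; that is, $K$ is strictly convex and is bounded by the $\mathcal C^2$ curve $\Gamma=\partial K$, $\gamma=pN+p'N'$, with radius of curvature $p+p''$. Let $F$ be the area of $K$, $L$ the length of $\Gamma$ and $\Delta=L^2-4\pi F$. Let $F_e$ be the area with sign and multiplicities swept by the radius vector of the evolute $\gamma-(p+p'')N$ of $\Gamma$, $0\le\varphi\le 2\pi$, i.e. the limit, as the mesh of the partition $0=\varphi_0\le\dots\le\varphi_n=2\pi$ tends to $0$, of the sums of the signed areas of the triangles with vertices at the origin and at two consecutive points of the evolute. Let $A$ be the area enclosed by the pedal curve of $K$ (the locus of the orthogonal projections on the support lines of $K$) with respect to the Steiner point $\frac1\pi\int_0^{2\pi}p(\varphi)N(\varphi)\,d\varphi$ of $K$. For $P\notin K$ let $\omega=\omega(P)$ be the visual angle of $\Gamma$ from $P$, the angle between the two tangents from $P$ to $\Gamma$, and let $dP$ be the area measure.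 Then $F_e$ exists, $\sin^3\omega$ is integrable over the complement of $K$, and $$\pi|F_e|-\Delta\ \ge\ \frac{40}{9}\left(\pi(A-F)+\frac23L^2-\frac89\int_{P\notin K}\sin^3\omega\,dP\right).$$ The right-hand side is strictly positive except when $\pi|F_e|-\Delta=0$, in which case it also vanishes. Equality holds if and only if one of the following assertions holds: (a) $K$ is a disk or is bounded by a curve parallel to an astroid (the hypocycloid with four cusps); (b) $K$ is bounded by a curve parallel to a Steiner curve (the hypocycloid with three cusps); (c) $K$ is a Minkowski sum of finitely many domains, each bounded by a circle of positive radius, a curve parallel to an astroid or a curve parallel to a Steiner curve. These domains need not be convex, and the sum is taken in the sense of generalized support functions: $p$ is the sum of the generalized support functions of these curves. Here a $\mathcal C^2$ function $f$ is the generalized support function of the envelope $fN+f'N'$ of the lines $x\cos\theta+y\sin\theta=f(\theta)$; the curves parallel to the curve with generalized support function $f$ are those with generalized support function $f+d$, $d\in\mathbb R$; and hypocycloids may be of any size and in any position in the plane. -/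

import Mathlib

open Real MeasureTheory

noncomputable section

namespace Hurwitz

/-- The Euclidean plane. -/
abbrev Plane : Type := EuclideanSpace ℝ (Fin 2)

/-- The unit vector `N(φ) = (cos φ, sin φ)`. -/
def N (φ : ℝ) : Plane := !₂[cos φ, sin φ]

/-- Its derivative `N'(φ) = (-sin φ, cos φ)`. -/
def N' (φ : ℝ) : Plane := !₂[-sin φ, cos φ]

/-- The determinant of two plane vectors. -/
def cross (u v : Plane) : ℝ := u 0 * v 1 - u 1 * v 0

/-- The rotation by the angle `α` about the origin. -/
def rotate (α : ℝ) (v : Plane) : Plane :=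
  !₂[cos α * v 0 - sin α * v 1, sin α * v 0 + cos α * v 1]

/-! ### Convex sets and support functions -/

/-- The support function `p(φ) = sup {⟪x, N φ⟫ : x ∈ K}`. -/
def supp (K : Set Plane) (φ : ℝ) : ℝ := sSup ((fun x : Plane => inner ℝ x (N φ)) '' K)

/-- The envelope of the lines `x cos θ + y sin θ = f θ`, parametrized by the normal angle `θ`:
the curve with generalized support function `f`. -/
def envelope (f : ℝ → ℝ) (θ : ℝ) : Plane := f θ • N θ + deriv f θ • N' θ

/-- The boundary curve of `K`, parametrized by the angle of its outer normal. -/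
def boundary (K : Set Plane) : ℝ → Plane := envelope (supp K)

/-- The radius of curvature `p + p''` of the boundary. -/
def curvRadius (K : Set Plane) (φ : ℝ) : ℝ := supp K φ + deriv (deriv (supp K)) φ

/-- The area of `K`. -/
def area (K : Set Plane) : ℝ := volume.real K

/-- The length of the boundary curve of `K`. -/
def perimeter (K : Set Plane) : ℝ := ∫ φ in (0 : ℝ)..2 * π, ‖deriv (boundary K) φ‖

/-- The isoperimetric deficit `Δ = L² - 4πF`. -/
def deficit (K : Set Plane) : ℝ := perimeter K ^ 2 - 4 * π * area K

/-! ### The evolute and its area with multiplicities -/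

/-- The evolute of the boundary of `K`, i.e. the curve of its centres of curvature. -/
def evolute (K : Set Plane) (φ : ℝ) : Plane := boundary K φ - curvRadius K φ • N φ

/-- `S` is the area, with sign and multiplicities, swept by the radius vector of the curve `c`
between the parameters `a` and `b`: the sums of the signed areas of the triangles with vertices
`0`, `c (t i)`, `c (t (i + 1))` tend to `S` as the mesh of the partition `t` tends to `0`.
For a `C¹` curve this is `½ ∫ (x dy - y dx)`; for a curve that is the envelope of a family with
a `C²` generalized support function `f` it is `½ ∫ f (f + f'')`. -/
def HasSweptArea (c : ℝ → Plane) (a b S : ℝ) : Prop :=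
  ∀ ε > 0, ∃ δ > 0, ∀ (n : ℕ) (t : ℕ → ℝ), t 0 = a → t n = b →
    (∀ i < n, t i ≤ t (i + 1) ∧ t (i + 1) - t i < δ) →
    |(∑ i ∈ Finset.range n, cross (c (t i)) (c (t (i + 1)))) / 2 - S| < ε

/-- The swept area is unique. -/
theorem HasSweptArea.unique {c : ℝ → Plane} {a b S T : ℝ} (hab : a ≤ b)
    (hS : HasSweptArea c a b S) (hT : HasSweptArea c a b T) : S = T := by
  by_contra hne
  have hpos : 0 < |S - T| / 2 := half_pos (abs_pos.mpr (sub_ne_zero.mpr hne))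
  obtain ⟨δ, hδ, h1⟩ := hS _ hpos
  obtain ⟨η, hη, h2⟩ := hT _ hpos
  obtain ⟨n, hn⟩ := exists_nat_gt ((b - a) / min δ η)
  have hm : 0 < min δ η := lt_min hδ hη
  have hn0 : (0 : ℝ) < n := lt_of_le_of_lt (div_nonneg (sub_nonneg.mpr hab) hm.le) hn
  have hstep : (b - a) / n < min δ η := by
    rw [div_lt_iff₀ hm] at hn
    rw [div_lt_iff₀ hn0]
    linarith
  have hge : 0 ≤ (b - a) / n := div_nonneg (sub_nonneg.mpr hab) hn0.le
  have hdiff : ∀ i : ℕ, (a + (i + 1 : ℕ) * ((b - a) / n)) - (a + i * ((b - a) / n))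
      = (b - a) / n := by
    intro i
    push_cast
    ring
  have hend : a + (n : ℝ) * ((b - a) / n) = b := by
    field_simp
    ring
  have e1 := h1 n (fun i => a + i * ((b - a) / n)) (by simp) hend
    (fun i _ => ⟨by linarith [hdiff i], by
      linarith [hdiff i, lt_of_lt_of_le hstep (min_le_left δ η)]⟩)
  have e2 := h2 n (fun i => a + i * ((b - a) / n)) (by simp) hend
    (fun i _ => ⟨by linarith [hdiff i], by
      linarith [hdiff i, lt_of_lt_of_le hstep (min_le_right δ η)]⟩)
  rw [abs_lt] at e1 e2
  have : |S - T| < |S - T| := by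
    rw [abs_lt]
    constructor <;> linarith [e1.1, e1.2, e2.1, e2.2]
  exact lt_irrefl _ this

/-! ### Steiner point and pedal curve -/

/-- The Steiner point `s(K) = (1/π) ∫ p(φ) N(φ) dφ`. -/
def steinerPoint (K : Set Plane) : Plane := (1 / π) • ∫ φ in (0 : ℝ)..2 * π, supp K φ • N φ

/-- The pedal curve of `K` with respect to `O`: the orthogonal projection of `O` on the support
line of `K` with outer normal `N φ`. -/
def pedal (K : Set Plane) (O : Plane) (φ : ℝ) : Plane :=
  O + (supp K φ - inner ℝ O (N φ)) • N φ

/-- The area enclosed by the pedal curve of `K` with respect to the Steiner point. As the Steiner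
point lies in `K`, the curve is star-shaped about it, and the enclosed region is the union of the
segments that join the Steiner point to the curve. -/
def pedalArea (K : Set Plane) : ℝ :=
  volume.real (⋃ φ : ℝ, segment ℝ (steinerPoint K) (pedal K (steinerPoint K) φ))

/-! ### Visual angle -/

/-- The points of `K` in which a support line of `K` through `P` touches `K`. -/
def tangencyPoints (K : Set Plane) (P : Plane) : Set Plane :=
  {x | x ∈ K ∧ ∃ φ : ℝ, inner ℝ x (N φ) = supp K φ ∧ inner ℝ P (N φ) = supp K φ}

/-- The visual angle of the boundary of `K` from the exterior point `P`: the angle at `P` between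
the two tangents from `P`. For a strictly convex `K` there are exactly two points of tangency
`x ≠ y`, so the set below is `{0, ∠ x P y}`. -/
def visualAngle (K : Set Plane) (P : Plane) : ℝ :=
  sSup {ω | ∃ x ∈ tangencyPoints K P, ∃ y ∈ tangencyPoints K P, ω = EuclideanGeometry.angle x P y}

/-- The lower bound `(40/9) (π (A - F) + (2/3) L² - (8/9) ∫_{P ∉ K} sin³ ω dP)`. -/
def pedalBound (K : Set Plane) : ℝ :=
  40 / 9 * (π * (pedalArea K - area K) + 2 / 3 * perimeter K ^ 2
    - 8 / 9 * ∫ P in Kᶜ, sin (visualAngle K P) ^ 3)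

/-! ### Hypocycloids, parallel curves, and sums -/

/-- The hypocycloid with `k` cusps traced by a point of a circle of radius `r` that rolls inside a
circle of radius `k r`. -/
def hypocycloid (k : ℕ) (r t : ℝ) : Plane :=
  !₂[r * (k - 1) * sin t - r * sin ((k - 1) * t), r * (k - 1) * cos t + r * cos ((k - 1) * t)]

/-- `f` is the generalized support function of a hypocycloid with `k` cusps in some position in
the plane: the envelope of the lines `x cos θ + y sin θ = f θ` is a hypocycloid rotated by some
`α` and translated by some `v`, where the normal angle `θ` and the parameter `t` of the hypocycloid
are related by `θ = (k - 2) t / 2 + α`. -/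
def IsHypocycloidSupport (k : ℕ) (f : ℝ → ℝ) : Prop :=
  ContDiff ℝ 2 f ∧ ∃ r > 0, ∃ (α : ℝ) (v : Plane), ∀ t : ℝ,
    envelope f (((k : ℝ) - 2) / 2 * t + α) = rotate α (hypocycloid k r t) + v

/-- `f` is the generalized support function of a curve parallel, at some signed distance `d`, to a
hypocycloid with `k` cusps. Such a curve need not be convex. -/
def IsParallelHypocycloidSupport (k : ℕ) (f : ℝ → ℝ) : Prop :=
  ∃ (g : ℝ → ℝ) (d : ℝ), IsHypocycloidSupport k g ∧ ∀ φ, f φ = g φ + d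

/-- `f` is the support function of a disk of positive radius. -/
def IsDiskSupport (f : ℝ → ℝ) : Prop :=
  ∃ (c : Plane) (ρ : ℝ), 0 < ρ ∧ f = supp (Metric.closedBall c ρ)

/-- `f` is the generalized support function of a circle, of a curve parallel to an astroid
(four cusps) or of a curve parallel to a Steiner curve (three cusps). -/
def IsBasicSupport (f : ℝ → ℝ) : Prop :=
  IsDiskSupport f ∨ IsParallelHypocycloidSupport 4 f ∨ IsParallelHypocycloidSupport 3 f

/-- `K` is a disk of positive radius, or its boundary is parallel to an astroid. -/
def IsDiskOrParallelAstroid (K : Set Plane) : Prop :=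
  (∃ (c : Plane) (ρ : ℝ), 0 < ρ ∧ K = Metric.closedBall c ρ) ∨
    IsParallelHypocycloidSupport 4 (supp K)

/-- The boundary of `K` is parallel to a Steiner curve. -/
def IsParallelSteinerCurve (K : Set Plane) : Prop := IsParallelHypocycloidSupport 3 (supp K)

/-- `K` is a Minkowski sum, in the sense of (generalized) support functions, of finitely many
domains bounded by circles or by curves parallel to an astroid or to a Steiner curve; these
domains need not be convex. -/
def IsMinkowskiSumOfBasic (K : Set Plane) : Prop :=
  ∃ (n : ℕ) (f : Fin n → ℝ → ℝ), (∀ i, IsBasicSupport (f i)) ∧ ∀ φ, supp K φ = ∑ i, f i φ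

end Hurwitz

end

namespace Hurwitz

/-! ### Convex bodies with a `C²` support function -/

/-! Every quantity in the inequality is a quadratic form in `p` that is diagonal in the harmonics of
`p`. Let e_n be the squared modulus of the n-th complex Fourier coefficient of `p` (`energy`), n
running over the integers. Then L² = 4π² e_0, F = π Σ (1 - n²) e_n and F_e = -π Σ (n⁴ - n²) e_n,
which is nonpositive. Hence π|F_e| - Δ is π² times the sum of (n² - 1)(n² - 4) e_n over n ≠ 0, and
only |n| ≥ 3 contributes (`hasSum_evolute_deficit`).

The pedal area about the Steiner point is half the integral of p² with the first harmonics removed,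
so π(A - F) = π² (Σ n² e_n - 2 e_1). The integral of sin³ ω equals (3/4) L² + 9π² e_2. Its L² part
cancels (2/3) L², and its e_2 part removes n = ±2, so the bracket on the right is π² times the sum
of n² e_n over |n| ≥ 3 (`hasSum_pedalBound`).

Finally (n² - 1)(n² - 4) - (40/9) n² = (n² - 9)(n² - 4/9), which is zero at |n| = 3 and positive
beyond (`pedalBound_spec`). Equality thus means that `p` is a trigonometric polynomial of degree at
most three: orders 0 and 1 form a disk, order 2 an astroid, order 3 a Steiner curve
(`isTrigCubic_iff_shape`).

The geometric work lies in three formulas. For `integral_sin_visualAngle_cubed`, exterior points are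
parametrized by the normal angles φ and φ + τ of their two support lines; then ω = π - τ, the
Jacobian is the product of the tangent lengths over sin τ, and integration by parts leaves an
autocorrelation of `p` with kernel 3/2 + (9/2) cos 2τ. The areas F and A come from polar coordinates
about the Steiner point, which is interior (`inner_steinerPoint_lt`, `area_star`). The evolute is
only continuous, so its swept area is computed from the triangle sums themselves
(`hasSweptArea_of_hasDerivAt`). -/

/-- A compact convex set with `C²` support function and positive radius of curvature. -/
structure IsSmoothBody (K : Set Plane) : Prop where
  nonempty : K.Nonempty
  isCompact : IsCompact K
  convex : Convex ℝ K
  contDiff : ContDiff ℝ 2 (supp K)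
  curvRadius_pos : ∀ φ, 0 < curvRadius K φ

@[simp] theorem N_zero (φ : ℝ) : N φ 0 = cos φ := rfl
@[simp] theorem N_one (φ : ℝ) : N φ 1 = sin φ := rfl
@[simp] theorem N'_zero (φ : ℝ) : N' φ 0 = -sin φ := rfl
@[simp] theorem N'_one (φ : ℝ) : N' φ 1 = cos φ := rfl

theorem inner_eq (x y : Plane) : inner ℝ x y = x 0 * y 0 + x 1 * y 1 := by
  simp [PiLp.inner_apply, Fin.sum_univ_two, mul_comm]

theorem inner_N (x : Plane) (φ : ℝ) : inner ℝ x (N φ) = x 0 * cos φ + x 1 * sin φ := by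
  simp [inner_eq]

theorem plane_ext {x y : Plane} (h0 : x 0 = y 0) (h1 : x 1 = y 1) : x = y := by
  ext i; fin_cases i <;> assumption

theorem N_add_two_pi (φ : ℝ) : N (φ + 2 * π) = N φ := by
  apply plane_ext <;> simp

theorem N'_add_two_pi (φ : ℝ) : N' (φ + 2 * π) = N' φ := by
  apply plane_ext <;> simp

theorem hasDerivAt_plane {f : ℝ → Plane} {f' : Plane} {x : ℝ}
    (h0 : HasDerivAt (fun t => f t 0) (f' 0) x) (h1 : HasDerivAt (fun t => f t 1) (f' 1) x) :
    HasDerivAt f f' x := by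
  rw [hasDerivAt_iff_hasFDerivAt, ← hasFDerivWithinAt_univ, hasFDerivWithinAt_euclidean]
  intro i; fin_cases i
  · exact (h0.hasFDerivAt.congr_fderiv (by ext; simp)).hasFDerivWithinAt
  · exact (h1.hasFDerivAt.congr_fderiv (by ext; simp)).hasFDerivWithinAt

theorem hasDerivAt_N (φ : ℝ) : HasDerivAt N (N' φ) φ :=
  hasDerivAt_plane (hasDerivAt_cos φ) (hasDerivAt_sin φ)

theorem hasDerivAt_N' (φ : ℝ) : HasDerivAt N' (-N φ) φ :=
  hasDerivAt_plane (hasDerivAt_sin φ).neg (by simpa using hasDerivAt_cos φ)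

theorem exists_eq_smul_N (v : Plane) : ∃ φ : ℝ, v = ‖v‖ • N φ := by
  refine ⟨Complex.arg (v 0 + v 1 * Complex.I), ?_⟩
  have hn : ‖v‖ = ‖(v 0 + v 1 * Complex.I : ℂ)‖ := by
    rw [EuclideanSpace.norm_eq, Complex.norm_add_mul_I]
    simp [Fin.sum_univ_two]
  have h := Complex.norm_mul_cos_arg (v 0 + v 1 * Complex.I : ℂ)
  have h' := Complex.norm_mul_sin_arg (v 0 + v 1 * Complex.I : ℂ)
  rw [← hn] at h h'
  apply plane_ext
  · simpa using h.symm
  · simpa using h'.symm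

theorem supp_periodic (K : Set Plane) : Function.Periodic (supp K) (2 * π) := by
  intro φ
  simp only [supp, N_add_two_pi]

theorem deriv_periodic {f : ℝ → ℝ} {T : ℝ} (h : Function.Periodic f T) :
    Function.Periodic (deriv f) T := by
  intro x
  have : (fun y => f (y + T)) = f := funext h
  rw [← deriv_comp_add_const, this]

/-! ### Support lines and their contact points. -/

namespace IsSmoothBody

variable {K : Set Plane} (hK : IsSmoothBody K)
include hK

theorem bddAbove (φ : ℝ) : BddAbove ((fun x : Plane => inner ℝ x (N φ)) '' K) :=
  (hK.isCompact.image (by fun_prop)).bddAbove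

theorem inner_le {x : Plane} (hx : x ∈ K) (φ : ℝ) : inner ℝ x (N φ) ≤ supp K φ :=
  le_csSup (hK.bddAbove φ) ⟨x, hx, rfl⟩

/-- A compact convex set is the intersection of its supporting half-planes. -/
theorem mem_iff {x : Plane} : x ∈ K ↔ ∀ φ, inner ℝ x (N φ) ≤ supp K φ := by
  refine ⟨fun hx => hK.inner_le hx, fun h => ?_⟩
  by_contra hx
  obtain ⟨f, u, hfu, hux⟩ :=
    geometric_hahn_banach_closed_point hK.convex hK.isCompact.isClosed hx
  set v := (InnerProductSpace.toDual ℝ Plane).symm f with hv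
  have hf : ∀ y, f y = inner ℝ y v := fun y => by
    rw [real_inner_comm, hv, InnerProductSpace.toDual_symm_apply]
  -- The separating functional is a nonnegative multiple of the pairing with `N φ`, so the
  -- half-plane at this φ is the violated one. Strictness comes from the separation; `‖v‖ ≥ 0` is
  -- enough.
  obtain ⟨φ, hφ⟩ := exists_eq_smul_N v
  have hf' : ∀ y, f y = ‖v‖ * inner ℝ y (N φ) := fun y => by
    rw [hf, ← real_inner_smul_right, ← hφ]
  have hne : (0 : ℝ) ≤ ‖v‖ := norm_nonneg v
  obtain ⟨y, hy, hmax⟩ := hK.isCompact.exists_isMaxOn hK.nonempty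
    (f := fun x : Plane => inner ℝ x (N φ)) (by fun_prop)
  have hsupp : supp K φ ≤ inner ℝ y (N φ) := by
    apply csSup_le (hK.nonempty.image _)
    rintro _ ⟨z, hz, rfl⟩
    exact hmax hz
  have h1 := hfu y hy
  rw [hf'] at h1 hux
  have := mul_le_mul_of_nonneg_left ((h φ).trans hsupp) hne
  linarith

theorem hasDerivAt_supp (φ : ℝ) : HasDerivAt (supp K) (deriv (supp K) φ) φ :=
  (hK.contDiff.differentiable (by norm_num) φ).hasDerivAt

theorem contDiff_deriv : ContDiff ℝ 1 (deriv (supp K)) :=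
  ((contDiff_succ_iff_deriv (n := 1)).1 (by simpa [one_add_one_eq_two] using hK.contDiff)).2.2

theorem hasDerivAt_deriv (φ : ℝ) :
    HasDerivAt (deriv (supp K)) (deriv (deriv (supp K)) φ) φ :=
  (hK.contDiff_deriv.differentiable (by norm_num) φ).hasDerivAt

theorem continuous_supp : Continuous (supp K) := hK.contDiff.continuous

theorem continuous_deriv : Continuous (deriv (supp K)) := hK.contDiff_deriv.continuous

theorem continuous_deriv2 : Continuous (deriv (deriv (supp K))) :=
  hK.contDiff_deriv.continuous_deriv le_rfl

omit hK in
theorem boundary_zero (φ : ℝ) :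
    boundary K φ 0 = supp K φ * cos φ - deriv (supp K) φ * sin φ := by
  simp [boundary, envelope]; ring

omit hK in
theorem boundary_one (φ : ℝ) :
    boundary K φ 1 = supp K φ * sin φ + deriv (supp K) φ * cos φ := by
  simp [boundary, envelope]

omit hK in
theorem boundary_periodic : Function.Periodic (boundary K) (2 * π) := by
  intro φ
  simp only [boundary, envelope, N_add_two_pi, N'_add_two_pi, supp_periodic K φ,
    deriv_periodic (supp_periodic K) φ]

omit hK in
theorem inner_boundary (φ ψ : ℝ) : inner ℝ (boundary K φ) (N ψ) =
    supp K φ * cos (ψ - φ) + deriv (supp K) φ * sin (ψ - φ) := by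
  rw [inner_N, boundary_zero, boundary_one, cos_sub, sin_sub]; ring

theorem hasDerivAt_boundary (φ : ℝ) :
    HasDerivAt (boundary K) (curvRadius K φ • N' φ) φ := by
  have h := ((hK.hasDerivAt_supp φ).smul (hasDerivAt_N φ)).add
    ((hK.hasDerivAt_deriv φ).smul (hasDerivAt_N' φ))
  refine h.congr_deriv ?_
  simp only [curvRadius]; module

theorem continuous_curvRadius : Continuous (curvRadius K) :=
  hK.continuous_supp.add hK.continuous_deriv2

/-- The left side is the pairing of the boundary point at φ + v with `N φ`. Its derivative in v is
-(p + p'')(φ + v) sin v, so it increases on [-π, 0], decreases on [0, π], and has its strict maximum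
at v = 0. All strict convexity used below comes from here. -/
theorem pull_back_lt {φ v : ℝ} (hv : v ≠ 0) (h1 : -π ≤ v) (h2 : v ≤ π) :
    supp K (φ + v) * cos v - deriv (supp K) (φ + v) * sin v < supp K φ := by
  set k : ℝ → ℝ := fun v => supp K (φ + v) * cos v - deriv (supp K) (φ + v) * sin v with hk
  have hd : ∀ v, HasDerivAt k (-(curvRadius K (φ + v) * sin v)) v := by
    intro v
    have a1 : HasDerivAt (fun v => supp K (φ + v)) (deriv (supp K) (φ + v)) v :=
      (hK.hasDerivAt_supp (φ + v)).comp_const_add φ v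
    have a2 : HasDerivAt (fun v => deriv (supp K) (φ + v)) (deriv (deriv (supp K)) (φ + v)) v :=
      (hK.hasDerivAt_deriv (φ + v)).comp_const_add φ v
    refine ((a1.mul (hasDerivAt_cos v)).sub (a2.mul (hasDerivAt_sin v))).congr_deriv ?_
    simp only [curvRadius]; ring
  have hc : Continuous k := continuous_iff_continuousAt.2 fun v => (hd v).continuousAt
  have h0 : k 0 = supp K φ := by simp [hk]
  rw [← h0]
  change k v < k 0
  rcases lt_or_gt_of_ne hv with hv | hv
  · have : StrictMonoOn k (Set.Icc (-π) 0) := by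
      apply strictMonoOn_of_deriv_pos (convex_Icc _ _) hc.continuousOn
      intro x hx
      rw [interior_Icc] at hx
      rw [(hd x).deriv]
      have := sin_neg_of_neg_of_neg_pi_lt hx.2 hx.1
      nlinarith [hK.curvRadius_pos (φ + x)]
    exact this ⟨h1, hv.le⟩ ⟨by linarith [pi_pos], le_rfl⟩ hv
  · have : StrictAntiOn k (Set.Icc 0 π) := by
      apply strictAntiOn_of_deriv_neg (convex_Icc _ _) hc.continuousOn
      intro x hx
      rw [interior_Icc] at hx
      rw [(hd x).deriv]
      have := sin_pos_of_mem_Ioo hx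
      nlinarith [hK.curvRadius_pos (φ + x)]
    exact this ⟨le_rfl, pi_pos.le⟩ ⟨hv.le, h2⟩ hv

/-- The boundary point with normal angle `φ` lies strictly inside all other support lines. -/
theorem inner_boundary_add_lt {φ u : ℝ} (h0 : 0 < u) (h1 : u < 2 * π) :
    supp K φ * cos u + deriv (supp K) φ * sin u < supp K (φ + u) := by
  -- `pull_back_lt` is based at the target angle φ + u. The way back to φ is -u when u ≤ π, and
  -- otherwise 2π - u modulo the period.
  rcases le_total u π with h | h
  · have := hK.pull_back_lt (φ := φ + u) (v := -u) (by linarith) (by linarith)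
      (by linarith [pi_pos])
    simpa using this
  · have := hK.pull_back_lt (φ := φ + u - 2 * π) (v := 2 * π - u) (by linarith) (by linarith)
      (by linarith [pi_pos])
    have e : φ + u - 2 * π + (2 * π - u) = φ := by ring
    rw [e, (supp_periodic K).sub_eq, cos_two_pi_sub, sin_two_pi_sub] at this
    linarith

theorem inner_boundary_lt {φ ψ : ℝ} (h0 : φ < ψ) (h1 : ψ < φ + 2 * π) :
    inner ℝ (boundary K φ) (N ψ) < supp K ψ := by
  have := hK.inner_boundary_add_lt (φ := φ) (u := ψ - φ) (by linarith) (by linarith)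
  rwa [inner_boundary, ← show φ + (ψ - φ) = ψ by ring, show φ + (ψ - φ) - φ = ψ - φ by ring]

omit hK in
theorem inner_boundary_self (φ : ℝ) : inner ℝ (boundary K φ) (N φ) = supp K φ := by
  simp [inner_boundary]

theorem inner_boundary_le (φ ψ : ℝ) : inner ℝ (boundary K φ) (N ψ) ≤ supp K ψ := by
  obtain ⟨ψ', hψ', h⟩ := (boundary_periodic (K := K)).exists_mem_Ico two_pi_pos φ ψ
  rw [h]
  rcases eq_or_lt_of_le hψ'.1 with h1 | h1
  · rw [← h1]; exact (inner_boundary_self ψ).le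
  · have := hK.inner_boundary_lt (φ := ψ' - 2 * π) (ψ := ψ) (by linarith [hψ'.2]) (by linarith)
    rw [(boundary_periodic (K := K)).sub_eq] at this
    exact this.le

theorem boundary_mem (φ : ℝ) : boundary K φ ∈ K := hK.mem_iff.2 (hK.inner_boundary_le φ)

/-- The support line with normal angle `φ` touches `K` in `boundary K φ` only. -/
theorem eq_boundary {x : Plane} (hx : x ∈ K) {φ : ℝ} (h : inner ℝ x (N φ) = supp K φ) :
    x = boundary K φ := by
  -- The gap between `p` and the pairing with x is nonnegative and vanishes at φ, so its derivative
  -- vanishes there. This fixes the component of x along `N' φ`.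
  set g : ℝ → ℝ := fun ψ => supp K ψ - (x 0 * cos ψ + x 1 * sin ψ) with hg
  have hd : HasDerivAt g (deriv (supp K) φ - (x 0 * -sin φ + x 1 * cos φ)) φ :=
    (hK.hasDerivAt_supp φ).sub
      (((hasDerivAt_cos φ).const_mul _).add ((hasDerivAt_sin φ).const_mul _))
  have hmin : IsLocalMin g φ := Filter.Eventually.of_forall fun ψ => by
    have h1 := hK.inner_le hx ψ
    rw [inner_N] at h h1
    simp only [hg]; linarith
  have h0 := hmin.hasDerivAt_eq_zero hd
  rw [inner_N] at h
  have hp : deriv (supp K) φ = x 0 * -sin φ + x 1 * cos φ := by linarith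
  have hs := sin_sq_add_cos_sq φ
  apply plane_ext
  · rw [boundary_zero, hp, ← h]; linear_combination (-x 0) * hs
  · rw [boundary_one, hp, ← h]; linear_combination (-x 1) * hs

/-- This is positivity of the width of K: the boundary point at φ is strictly inside the opposite
support line. -/
theorem supp_add_pi_pos (φ : ℝ) : 0 < supp K φ + supp K (φ + π) := by
  have := hK.inner_boundary_add_lt (φ := φ) pi_pos (by linarith [pi_pos])
  simp at this
  linarith

end IsSmoothBody

/-! ### Change of variables in the plane -/

/-- The Cartesian coordinates, as a measurable equivalence. -/
noncomputable def coordEquiv : Plane ≃ᵐ ℝ × ℝ :=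
  (MeasurableEquiv.toLp 2 (Fin 2 → ℝ)).symm.trans MeasurableEquiv.finTwoArrow

/-- The Cartesian coordinates, as a continuous linear map. -/
noncomputable def coordCLM : Plane →L[ℝ] ℝ × ℝ :=
  (EuclideanSpace.proj (𝕜 := ℝ) (0 : Fin 2)).prod (EuclideanSpace.proj (𝕜 := ℝ) (1 : Fin 2))

theorem coordCLM_apply (x : Plane) : coordCLM x = (x 0, x 1) := rfl

theorem measurePreserving_coordEquiv : MeasurePreserving coordEquiv :=
  (PiLp.volume_preserving_ofLp (Fin 2)).trans (volume_preserving_finTwoArrow ℝ)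

/-- The linear map `(a, b) ↦ a • u + b • v`. -/
noncomputable def columns (u v : Plane) : ℝ × ℝ →L[ℝ] Plane :=
  (ContinuousLinearMap.fst ℝ ℝ ℝ).smulRight u + (ContinuousLinearMap.snd ℝ ℝ ℝ).smulRight v

theorem columns_apply (u v : Plane) (x : ℝ × ℝ) : columns u v x = x.1 • u + x.2 • v := rfl

/-- A Jacobian determinant requires an endomorphism. Precomposing with the measure-preserving
coordinates makes one out of a parametrization of the plane by ℝ × ℝ. -/
theorem det_columns (u v : Plane) : ((columns u v).comp coordCLM).det = cross u v := by
  have : ((columns u v).comp coordCLM : Plane →L[ℝ] Plane).det =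
      LinearMap.det ((columns u v).comp coordCLM : Plane →ₗ[ℝ] Plane) := rfl
  rw [this, ← LinearMap.det_toMatrix (EuclideanSpace.basisFun (Fin 2) ℝ).toBasis,
    Matrix.det_fin_two]
  simp [LinearMap.toMatrix_apply, columns_apply, coordCLM_apply, cross]
  ring

section ChangeOfVariables

variable {S : Set (ℝ × ℝ)} {Φ : ℝ × ℝ → Plane} {u v : ℝ × ℝ → Plane}

theorem hasFDerivWithinAt_comp_coord (hd : ∀ x ∈ S, HasFDerivWithinAt Φ (columns (u x) (v x)) S x) :
    ∀ x ∈ coordEquiv ⁻¹' S, HasFDerivWithinAt (Φ ∘ coordEquiv)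
      ((columns (u (coordEquiv x)) (v (coordEquiv x))).comp coordCLM) (coordEquiv ⁻¹' S) x :=
  fun x hx => (hd _ hx).comp x coordCLM.hasFDerivWithinAt (fun _ h => h)

theorem image_comp_coord (S : Set (ℝ × ℝ)) (Φ : ℝ × ℝ → Plane) :
    (Φ ∘ coordEquiv) '' (coordEquiv ⁻¹' S) = Φ '' S := by
  rw [Set.image_comp, Set.image_preimage_eq _ coordEquiv.surjective]

theorem setIntegral_image_eq (hS : MeasurableSet S)
    (hd : ∀ x ∈ S, HasFDerivWithinAt Φ (columns (u x) (v x)) S x) (hinj : S.InjOn Φ)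
    (f : Plane → ℝ) : ∫ P in Φ '' S, f P = ∫ x in S, |cross (u x) (v x)| * f (Φ x) := by
  rw [← image_comp_coord, integral_image_eq_integral_abs_det_fderiv_smul volume
    (coordEquiv.measurable hS) (hasFDerivWithinAt_comp_coord hd)
    (fun x hx y hy h => coordEquiv.injective (hinj hx hy h))]
  simp only [det_columns, smul_eq_mul, Function.comp]
  exact measurePreserving_coordEquiv.setIntegral_preimage_emb coordEquiv.measurableEmbedding
    (fun x => |cross (u x) (v x)| * f (Φ x)) S

theorem integrableOn_image_iff (hS : MeasurableSet S)
    (hd : ∀ x ∈ S, HasFDerivWithinAt Φ (columns (u x) (v x)) S x) (hinj : S.InjOn Φ)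
    (f : Plane → ℝ) : IntegrableOn f (Φ '' S) ↔
      IntegrableOn (fun x => |cross (u x) (v x)| * f (Φ x)) S := by
  rw [← image_comp_coord, integrableOn_image_iff_integrableOn_abs_det_fderiv_smul volume
    (coordEquiv.measurable hS) (hasFDerivWithinAt_comp_coord hd)
    (fun x hx y hy h => coordEquiv.injective (hinj hx hy h))]
  simp only [det_columns, smul_eq_mul, Function.comp]
  exact measurePreserving_coordEquiv.integrableOn_comp_preimage coordEquiv.measurableEmbedding
    (f := fun x => |cross (u x) (v x)| * f (Φ x))

end ChangeOfVariables

/-- Double integrals of continuous functions over a half-open rectangle. -/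
theorem setIntegral_rectangle {E : ℝ × ℝ → ℝ} (hE : Continuous E) {a b c d : ℝ} (hab : a ≤ b)
    (hcd : c ≤ d) {s t : Set ℝ} (hs : s =ᵐ[volume] Set.Ioc a b) (ht : t =ᵐ[volume] Set.Ioc c d) :
    IntegrableOn E (s ×ˢ t) ∧
      ∫ x in s ×ˢ t, E x = ∫ φ in a..b, ∫ τ in c..d, E (φ, τ) := by
  have hst : (s ×ˢ t : Set (ℝ × ℝ)) =ᵐ[volume] Set.Ioc a b ×ˢ Set.Ioc c d :=
    Measure.set_prod_ae_eq hs ht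
  have hint : IntegrableOn E (Set.Ioc a b ×ˢ Set.Ioc c d) :=
    (hE.continuousOn.integrableOn_compact (isCompact_Icc.prod isCompact_Icc)).mono_set
      (Set.prod_mono Set.Ioc_subset_Icc_self Set.Ioc_subset_Icc_self)
  refine ⟨hint.congr_set_ae hst, ?_⟩
  rw [setIntegral_congr_set hst, Measure.volume_eq_prod, setIntegral_prod _ hint,
    intervalIntegral.integral_of_le hab]
  simp_rw [intervalIntegral.integral_of_le hcd]

/-! ### Exterior points as intersections of two support lines -/

/-- `P` is the intersection of the support lines with normal angles `φ` and `φ + τ`. -/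
structure IsCorner (K : Set Plane) (P : Plane) (φ τ : ℝ) : Prop where
  pos : 0 < τ
  lt_pi : τ < π
  left : inner ℝ P (N φ) = supp K φ
  right : inner ℝ P (N (φ + τ)) = supp K (φ + τ)

/-- The length of the tangent at the point with normal angle `φ`, up to the support line with
normal angle `φ + τ`. -/
noncomputable def tangentLeft (K : Set Plane) (φ τ : ℝ) : ℝ :=
  (supp K (φ + τ) - supp K φ * cos τ - deriv (supp K) φ * sin τ) / sin τ

/-- The length of the tangent at the point with normal angle `φ + τ`, up to the support line with
normal angle `φ`. -/
noncomputable def tangentRight (K : Set Plane) (φ τ : ℝ) : ℝ :=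
  (supp K φ - supp K (φ + τ) * cos τ + deriv (supp K) (φ + τ) * sin τ) / sin τ

theorem sin_ne_zero_of_Ioo {τ : ℝ} (h0 : 0 < τ) (h1 : τ < π) : sin τ ≠ 0 :=
  (sin_pos_of_pos_of_lt_pi h0 h1).ne'

theorem inner_add_smul_N' (x : Plane) (t φ ψ : ℝ) :
    inner ℝ (x + t • N' φ) (N ψ) = inner ℝ x (N ψ) + t * sin (ψ - φ) := by
  simp only [inner_N, sin_sub, PiLp.add_apply, PiLp.smul_apply, N'_zero, N'_one, smul_eq_mul]
  ring

/-- A point is determined by its inner products with two independent directions. -/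
theorem eq_of_inner_eq {P Q : Plane} {φ τ : ℝ} (hs : sin τ ≠ 0)
    (h1 : inner ℝ P (N φ) = inner ℝ Q (N φ))
    (h2 : inner ℝ P (N (φ + τ)) = inner ℝ Q (N (φ + τ))) : P = Q := by
  simp only [inner_N, cos_add, sin_add] at h1 h2
  have hsc := sin_sq_add_cos_sq φ
  apply plane_ext
  · apply mul_left_cancel₀ hs
    linear_combination (cos τ * sin φ + sin τ * cos φ) * h1 - sin φ * h2 +
      sin τ * (Q 0 - P 0) * hsc
  · apply mul_left_cancel₀ hs
    linear_combination (-cos τ * cos φ + sin τ * sin φ) * h1 + cos φ * h2 +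
      sin τ * (Q 1 - P 1) * hsc

namespace IsSmoothBody

variable {K : Set Plane} (hK : IsSmoothBody K)
include hK

theorem tangentLeft_pos {φ τ : ℝ} (h0 : 0 < τ) (h1 : τ < π) : 0 < tangentLeft K φ τ := by
  have := hK.inner_boundary_add_lt (φ := φ) h0 (by linarith)
  exact div_pos (by linarith) (sin_pos_of_pos_of_lt_pi h0 h1)

theorem tangentRight_pos {φ τ : ℝ} (h0 : 0 < τ) (h1 : τ < π) : 0 < tangentRight K φ τ := by
  have := hK.pull_back_lt (φ := φ) h0.ne' (by linarith) h1.le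
  exact div_pos (by linarith) (sin_pos_of_pos_of_lt_pi h0 h1)

end IsSmoothBody

namespace IsCorner

variable {K : Set Plane} {P : Plane} {φ τ : ℝ} (h : IsCorner K P φ τ)
include h

theorem eq_left : P = boundary K φ + tangentLeft K φ τ • N' φ := by
  have hs := sin_ne_zero_of_Ioo h.pos h.lt_pi
  apply eq_of_inner_eq (φ := φ) hs
  · rw [h.left, inner_add_smul_N', IsSmoothBody.inner_boundary]; simp
  · rw [h.right, inner_add_smul_N', IsSmoothBody.inner_boundary, tangentLeft, add_sub_cancel_left,
      div_mul_cancel₀ _ hs]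
    ring

theorem eq_right : P = boundary K (φ + τ) - tangentRight K φ τ • N' (φ + τ) := by
  have hs := sin_ne_zero_of_Ioo h.pos h.lt_pi
  rw [sub_eq_add_neg, ← neg_smul]
  apply eq_of_inner_eq (φ := φ) hs
  · have e : φ - (φ + τ) = -τ := by ring
    rw [h.left, inner_add_smul_N', IsSmoothBody.inner_boundary, tangentRight, e, sin_neg, cos_neg,
      neg_mul_neg, div_mul_cancel₀ _ hs]
    ring
  · rw [h.right, inner_add_smul_N', IsSmoothBody.inner_boundary]; simp

/-- For 0 < u < τ, sin τ · N(φ + u) = sin(τ - u) · N φ + sin u · N(φ + τ) with positive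
coefficients. In both end directions P lies on the support line, while the boundary point at φ + u
lies strictly below it. -/
theorem supp_lt (hK : IsSmoothBody K) {u : ℝ} (h0 : 0 < u) (h1 : u < τ) :
    supp K (φ + u) < inner ℝ P (N (φ + u)) := by
  have hτ := h.lt_pi
  have a1 := hK.pull_back_lt (φ := φ) (v := u) h0.ne' (by linarith) (by linarith)
  have a2 := hK.pull_back_lt (φ := φ + τ) (v := u - τ) (by linarith) (by linarith) (by linarith)
  have e : φ + τ + (u - τ) = φ + u := by ring
  rw [e] at a2
  have s1 := sin_pos_of_pos_of_lt_pi h0 (by linarith)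
  have s2 : 0 < sin (τ - u) := sin_pos_of_pos_of_lt_pi (by linarith) (by linarith)
  have s3 := sin_pos_of_pos_of_lt_pi h.pos hτ
  have key : inner ℝ P (N (φ + u)) * sin τ =
      sin (τ - u) * supp K φ + sin u * supp K (φ + τ) := by
    rw [← h.left, ← h.right]
    simp only [inner_N, cos_add, sin_add, sin_sub]
    ring
  have n1 := mul_lt_mul_of_pos_left a1 s2
  have n2 := mul_lt_mul_of_pos_left a2 s1
  have e1 : cos (u - τ) = cos u * cos τ + sin u * sin τ := cos_sub _ _
  have e2 : sin (u - τ) = sin u * cos τ - cos u * sin τ := sin_sub _ _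
  have key2 : supp K (φ + u) * sin τ =
      sin (τ - u) * (supp K (φ + u) * cos u - deriv (supp K) (φ + u) * sin u) +
      sin u * (supp K (φ + u) * cos (u - τ) - deriv (supp K) (φ + u) * sin (u - τ)) := by
    rw [e1, e2, sin_sub]
    linear_combination (-supp K (φ + u) * sin τ) * sin_sq_add_cos_sq u
  refine lt_of_mul_lt_mul_right ?_ s3.le
  rw [key, key2]
  linarith

/-- P is a contact point moved along its tangent. Starting from the contact at φ + τ when u ≤ π, and
from the one at φ when u ≥ π, the displacement has nonpositive component along `N (φ + u)`. -/
theorem lt_supp (hK : IsSmoothBody K) {u : ℝ} (h0 : τ < u) (h1 : u < 2 * π) :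
    inner ℝ P (N (φ + u)) < supp K (φ + u) := by
  have hτ := h.lt_pi
  have h2 := h.pos
  rcases le_total u π with hu | hu
  · rw [h.eq_right, sub_eq_add_neg, ← neg_smul, inner_add_smul_N']
    have a := hK.inner_boundary_lt (φ := φ + τ) (ψ := φ + u) (by linarith) (by linarith)
    have b := hK.tangentRight_pos (φ := φ) h.pos hτ
    have c : 0 ≤ sin (φ + u - (φ + τ)) :=
      sin_nonneg_of_nonneg_of_le_pi (by linarith) (by linarith)
    nlinarith
  · rw [h.eq_left, inner_add_smul_N']
    have a := hK.inner_boundary_lt (φ := φ) (ψ := φ + u) (by linarith) (by linarith)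
    have b := hK.tangentLeft_pos (φ := φ) h.pos hτ
    have c : 0 ≤ sin (2 * π - u) :=
      sin_nonneg_of_nonneg_of_le_pi (by linarith) (by linarith)
    rw [sin_two_pi_sub] at c
    rw [add_sub_cancel_left]
    nlinarith

theorem notMem (hK : IsSmoothBody K) : P ∉ K := fun hP =>
  absurd (hK.inner_le hP (φ + τ / 2))
    (not_le.2 (h.supp_lt hK (by linarith [h.pos]) (by linarith [h.pos])))

theorem eq_zero_or_eq (hK : IsSmoothBody K) {u : ℝ} (h0 : 0 ≤ u) (h1 : u < 2 * π)
    (hu : inner ℝ P (N (φ + u)) = supp K (φ + u)) : u = 0 ∨ u = τ := by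
  rcases eq_or_lt_of_le h0 with h0 | h0
  · exact .inl h0.symm
  rcases lt_trichotomy u τ with h2 | h2 | h2
  · exact absurd hu (h.supp_lt hK h0 h2).ne'
  · exact .inr h2
  · exact absurd hu (h.lt_supp hK h2 h1).ne

theorem unique (hK : IsSmoothBody K) {φ' τ' : ℝ} (h' : IsCorner K P φ' τ')
    (hle : φ ≤ φ') (hlt : φ' < φ + 2 * π) : φ = φ' ∧ τ = τ' := by
  have hτ := h.lt_pi
  have hτ' := h'.lt_pi
  have hτ0 := h.pos
  have hτ0' := h'.pos
  have e : φ + (φ' - φ) = φ' := by ring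
  rcases h.eq_zero_or_eq hK (u := φ' - φ) (by linarith) (by linarith) (by rw [e, h'.left])
    with hu | hu
  · have hφ : φ = φ' := by linarith
    subst hφ
    refine ⟨rfl, ?_⟩
    rcases h.eq_zero_or_eq hK (u := τ') (by linarith) (by linarith) h'.right with h2 | h2
    · linarith
    · exact h2.symm
  -- If φ' = φ + τ, then a further support line through P would occur at relative angle τ + τ',
  -- strictly between τ and 2π.
  · have e2 : φ + (τ + τ') = φ' + τ' := by linarith
    have := h.lt_supp hK (u := τ + τ') (by linarith) (by linarith)
    rw [e2, h'.right] at this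
    exact absurd this (lt_irrefl _)

theorem tangencyPoints_eq (hK : IsSmoothBody K) :
    tangencyPoints K P = {boundary K φ, boundary K (φ + τ)} := by
  ext x
  constructor
  · rintro ⟨hx, ψ, h1, h2⟩
    obtain ⟨ψ', hψ', he⟩ := (show Function.Periodic (fun ψ => (boundary K ψ, supp K ψ, N ψ)) (2 * π)
      from fun ψ => by simp only [IsSmoothBody.boundary_periodic ψ, supp_periodic K ψ,
        N_add_two_pi]).exists_mem_Ico two_pi_pos ψ φ
    simp only [Prod.mk.injEq] at he
    rw [hK.eq_boundary hx h1, he.1]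
    rw [he.2.1, he.2.2] at h2
    have e : φ + (ψ' - φ) = ψ' := by ring
    rcases h.eq_zero_or_eq hK (u := ψ' - φ) (by linarith [hψ'.1]) (by linarith [hψ'.2])
      (by rw [e, h2]) with hu | hu
    · left; rw [show ψ' = φ by linarith]
    · right; rw [show ψ' = φ + τ by linarith]; rfl
  · rintro (rfl | rfl)
    · exact ⟨hK.boundary_mem φ, φ, IsSmoothBody.inner_boundary_self φ, h.left⟩
    · exact ⟨hK.boundary_mem _, φ + τ, IsSmoothBody.inner_boundary_self _, h.right⟩

/-- Seen from P, the contact points lie in the directions -N'(φ) and N'(φ + τ), because both tangent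
lengths are positive. -/
theorem angle_eq (hK : IsSmoothBody K) :
    EuclideanGeometry.angle (boundary K φ) P (boundary K (φ + τ)) = π - τ := by
  have hτ := h.lt_pi
  have hτ0 := h.pos
  have e1 : boundary K φ -ᵥ P = (-tangentLeft K φ τ) • N' φ := by
    conv_lhs => rw [h.eq_left]
    simp
  have e2 : boundary K (φ + τ) -ᵥ P = tangentRight K φ τ • N' (φ + τ) := by
    conv_lhs => rw [h.eq_right]
    simp
  have hn : ∀ ψ, ‖N' ψ‖ = 1 := fun ψ => by
    rw [EuclideanSpace.norm_eq]; simp [Fin.sum_univ_two]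
  rw [EuclideanGeometry.angle, e1, e2,
    InnerProductGeometry.angle_smul_right_of_pos _ _ (hK.tangentRight_pos hτ0 hτ), neg_smul,
    InnerProductGeometry.angle_neg_left,
    InnerProductGeometry.angle_smul_left_of_pos _ _ (hK.tangentLeft_pos hτ0 hτ),
    InnerProductGeometry.angle, hn, hn]
  congr 1
  have : inner ℝ (N' φ) (N' (φ + τ)) / (1 * 1) = cos τ := by
    rw [inner_eq]
    simp only [N'_zero, N'_one, sin_add, cos_add]
    linear_combination cos τ * sin_sq_add_cos_sq φ
  rw [this, arccos_cos hτ0.le hτ.le]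

theorem visualAngle_eq (hK : IsSmoothBody K) : visualAngle K P = π - τ := by
  have hτ := h.lt_pi
  -- The angle of a point with itself is 0 only away from the vertex; at the vertex it has the
  -- default value π/2, which would spoil the supremum.
  have hne : ∀ x ∈ K, x ≠ P := fun x hx e => h.notMem hK (e ▸ hx)
  have hset : {ω | ∃ x ∈ tangencyPoints K P, ∃ y ∈ tangencyPoints K P,
      ω = EuclideanGeometry.angle x P y} = {0, π - τ} := by
    rw [h.tangencyPoints_eq hK]
    ext ω
    simp only [Set.mem_ofPred_eq, Set.mem_insert_iff, Set.mem_singleton_iff, exists_eq_or_imp,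
      exists_eq_left, h.angle_eq hK,
      EuclideanGeometry.angle_self_of_ne (hne _ (hK.boundary_mem φ)),
      EuclideanGeometry.angle_self_of_ne (hne _ (hK.boundary_mem (φ + τ))),
      EuclideanGeometry.angle_comm (boundary K (φ + τ)) P (boundary K φ)]
    tauto
  rw [visualAngle, hset, csSup_pair]
  exact max_eq_right (by linarith)

end IsCorner

namespace IsSmoothBody

variable {K : Set Plane} (hK : IsSmoothBody K)
include hK

/-- Through an exterior point pass two support lines. -/
theorem exists_isCorner {P : Plane} (hP : P ∉ K) :
    ∃ φ ∈ Set.Ico 0 (2 * π), ∃ τ, IsCorner K P φ τ := by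
  suffices ∃ φ τ, IsCorner K P φ τ by
    obtain ⟨φ, τ, h⟩ := this
    obtain ⟨φ', hφ', he⟩ := (show Function.Periodic
      (fun ψ => (supp K ψ, N ψ, supp K (ψ + τ), N (ψ + τ))) (2 * π)
      from fun ψ => by simp only [add_right_comm ψ, supp_periodic K _,
        N_add_two_pi]).exists_mem_Ico two_pi_pos φ 0
    simp only [Prod.mk.injEq] at he
    rw [zero_add] at hφ'
    exact ⟨φ', hφ', τ, h.pos, h.lt_pi, by rw [← he.1, ← he.2.1, h.left],
      by rw [← he.2.2.1, ← he.2.2.2, h.right]⟩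
  rw [hK.mem_iff] at hP
  push Not at hP
  obtain ⟨ψ, hψ⟩ := hP
  set g : ℝ → ℝ := fun θ => supp K θ - inner ℝ P (N θ) with hg
  have hgc : Continuous g := by
    have := hK.continuous_supp
    simp only [hg, inner_N]
    fun_prop
  have hgp : ∀ θ, 0 < g θ + g (θ + π) := fun θ => by
    have := hK.supp_add_pi_pos θ
    simp only [hg, inner_N, cos_add_pi, sin_add_pi]
    linarith
  have hψ0 : g ψ < 0 := by simp only [hg]; linarith
  have hψ1 : 0 < g (ψ + π) := by linarith [hgp ψ]
  have hψ2 : 0 < g (ψ - π) := by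
    have := hgp (ψ - π)
    rw [sub_add_cancel] at this
    linarith
  -- The gap g is negative at ψ and, by positivity of the width, positive at ψ ± π. Its zeros on the
  -- two sides of ψ are the two normal angles.
  obtain ⟨b, hb, hb0⟩ := intermediate_value_Ioo (by linarith [pi_pos]) hgc.continuousOn
    (show (0 : ℝ) ∈ Set.Ioo (g ψ) (g (ψ + π)) from ⟨hψ0, hψ1⟩)
  obtain ⟨a, ha, ha0⟩ := intermediate_value_Ioo' (by linarith [pi_pos]) hgc.continuousOn
    (show (0 : ℝ) ∈ Set.Ioo (g ψ) (g (ψ - π)) from ⟨hψ0, hψ2⟩)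
  have eb : a + (b - a) = b := by ring
  -- A difference of exactly π contradicts the width. Beyond π, a combination of `N a`, `N b`, `N ψ`
  -- with positive coefficients is zero; comparing x in K with P in these three directions gives 0 <
  -- 0.
  have hlt : b - a < π := by
    by_contra! hge
    rcases eq_or_lt_of_le hge with he | hlt
    · have := hgp a
      rw [he, eb] at this
      linarith
    · obtain ⟨x, hx⟩ := hK.nonempty
      have s1 : 0 < sin (b - ψ) := sin_pos_of_pos_of_lt_pi (by linarith [hb.1]) (by linarith [hb.2])
      have s2 : 0 < sin (ψ - a) := sin_pos_of_pos_of_lt_pi (by linarith [ha.2]) (by linarith [ha.1])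
      have s3 : 0 < sin (b - a - π) :=
        sin_pos_of_pos_of_lt_pi (by linarith) (by linarith [ha.1, hb.2])
      rw [sin_sub_pi] at s3
      have i1 := mul_le_mul_of_nonneg_left (hK.inner_le hx a) s1.le
      have i2 := mul_le_mul_of_nonneg_left (hK.inner_le hx b) s2.le
      have i3 := mul_le_mul_of_nonneg_left (hK.inner_le hx ψ) s3.le
      have i4 := mul_lt_mul_of_pos_left hψ s3
      simp only [hg] at ha0 hb0
      rw [sub_eq_zero.1 ha0] at i1
      rw [sub_eq_zero.1 hb0] at i2
      simp only [inner_N, sin_sub] at i1 i2 i3 i4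
      nlinarith
  refine ⟨a, b - a, by linarith [ha.2, hb.1], hlt, ?_, ?_⟩
  · simp only [hg] at ha0; linarith
  · rw [eb]; simp only [hg] at hb0; linarith

end IsSmoothBody

/-- The intersection of the support lines with normal angles `φ` and `φ + τ`. -/
noncomputable def corner (K : Set Plane) (x : ℝ × ℝ) : Plane :=
  supp K x.1 • N x.1 + ((supp K (x.1 + x.2) - supp K x.1 * cos x.2) / sin x.2) • N' x.1

theorem isCorner_corner (K : Set Plane) {φ τ : ℝ} (h0 : 0 < τ) (h1 : τ < π) :
    IsCorner K (corner K (φ, τ)) φ τ := by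
  have hs := sin_ne_zero_of_Ioo h0 h1
  have hN : ∀ ψ, inner ℝ (supp K φ • N φ) (N ψ) = supp K φ * cos (ψ - φ) := fun ψ => by
    simp only [inner_N, cos_sub, PiLp.smul_apply, N_zero, N_one, smul_eq_mul]; ring
  refine ⟨h0, h1, ?_, ?_⟩
  · simp [corner, inner_add_smul_N', hN]
  · simp only [corner, inner_add_smul_N', hN, add_sub_cancel_left]
    rw [div_mul_cancel₀ _ hs]; ring

/-- The parameters of the exterior points. -/
def cornerDomain : Set (ℝ × ℝ) := Set.Ico 0 (2 * π) ×ˢ Set.Ioo 0 π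

namespace IsSmoothBody

variable {K : Set Plane} (hK : IsSmoothBody K)
include hK

theorem injOn_corner : cornerDomain.InjOn (corner K) := by
  rintro ⟨φ, τ⟩ ⟨hφ, hτ⟩ ⟨φ', τ'⟩ ⟨hφ', hτ'⟩ he
  have h := isCorner_corner K (φ := φ) hτ.1 hτ.2
  have h' := isCorner_corner K (φ := φ') hτ'.1 hτ'.2
  rw [← he] at h'
  simp only [Set.mem_Ico] at hφ hφ'
  rcases le_total φ φ' with hle | hle
  · obtain ⟨rfl, rfl⟩ := h.unique hK h' hle (by linarith); rfl
  · obtain ⟨rfl, rfl⟩ := h'.unique hK h hle (by linarith); rfl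

theorem image_corner : corner K '' cornerDomain = Kᶜ := by
  ext P
  constructor
  · rintro ⟨⟨φ, τ⟩, ⟨-, hτ⟩, rfl⟩
    exact (isCorner_corner K hτ.1 hτ.2).notMem hK
  · intro hP
    obtain ⟨φ, hφ, τ, h⟩ := hK.exists_isCorner hP
    refine ⟨(φ, τ), ⟨hφ, h.pos, h.lt_pi⟩, ?_⟩
    have h' := isCorner_corner K (φ := φ) h.pos h.lt_pi
    exact eq_of_inner_eq (φ := φ) (sin_ne_zero_of_Ioo h.pos h.lt_pi) (h'.left.trans h.left.symm)
      (h'.right.trans h.right.symm)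

end IsSmoothBody

/-! ### Integrals over a period -/

theorem intervalIntegral_swap {f : ℝ × ℝ → ℝ} (hf : Continuous f) {a b c d : ℝ} (hab : a ≤ b)
    (hcd : c ≤ d) : ∫ x in a..b, ∫ y in c..d, f (x, y) = ∫ y in c..d, ∫ x in a..b, f (x, y) := by
  have h := (setIntegral_rectangle hf hab hcd (s := Set.Ioc a b) (t := Set.Ioc c d)
    Filter.EventuallyEq.rfl Filter.EventuallyEq.rfl).1
  rw [IntegrableOn, Measure.volume_eq_prod, ← Measure.prod_restrict] at h
  have := integral_integral_swap (f := fun x y => f (x, y)) h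
  simpa only [intervalIntegral.integral_of_le hab, intervalIntegral.integral_of_le hcd] using this

theorem integral_deriv_eq_zero {g g' : ℝ → ℝ} (hg : ∀ x, HasDerivAt g (g' x) x)
    (hc : Continuous g') {a b : ℝ} (h : g a = g b) : ∫ x in a..b, g' x = 0 := by
  rw [intervalIntegral.integral_eq_sub_of_hasDerivAt (fun x _ => hg x)
    (hc.intervalIntegrable _ _), h, sub_self]

theorem integral_shift {g : ℝ → ℝ} (hg : Function.Periodic g (2 * π)) (a : ℝ) :
    ∫ x in (0 : ℝ)..2 * π, g (a + x) = ∫ x in (0 : ℝ)..2 * π, g x := by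
  rw [intervalIntegral.integral_comp_add_left, add_zero, hg.intervalIntegral_add_eq a 0, zero_add]

theorem continuous_intervalIntegral {f : ℝ × ℝ → ℝ} (hf : Continuous f) (a b : ℝ) :
    Continuous fun y => ∫ x in a..b, f (x, y) :=
  intervalIntegral.continuous_parametric_intervalIntegral_of_continuous'
    (f := fun y x => f (x, y)) (by fun_prop) a b

section TangentProduct

variable {p q r : ℝ → ℝ}

/-- The integral of an even trigonometric kernel against the autocorrelation of `p`. -/
theorem integral_autocorrelation (hp : Continuous p) (hper : Function.Periodic p (2 * π)) :
    ∫ φ in (0 : ℝ)..2 * π, ∫ τ in (0 : ℝ)..π,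
      (3 / 2 + 9 / 2 * cos (2 * τ)) * (p φ * p (φ + τ)) =
    3 / 4 * (∫ φ in (0 : ℝ)..2 * π, p φ) ^ 2 +
      9 / 4 * ((∫ φ in (0 : ℝ)..2 * π, p φ * cos (2 * φ)) ^ 2 +
        (∫ φ in (0 : ℝ)..2 * π, p φ * sin (2 * φ)) ^ 2) := by
  set f : ℝ × ℝ → ℝ := fun x => (3 / 2 + 9 / 2 * cos (2 * x.2)) * (p x.1 * p (x.1 + x.2)) with hf
  have hfc : Continuous f := by fun_prop
  set k : ℝ → ℝ := fun τ => ∫ φ in (0 : ℝ)..2 * π, f (φ, τ) with hk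
  have hkc : Continuous k := continuous_intervalIntegral hfc 0 (2 * π)
  -- Shifting φ by τ exchanges the two factors of the autocorrelation, and the kernel is even. So
  -- the integral over [0, π] is half of that over a full period.
  have hsymm : ∀ τ, k (2 * π - τ) = k τ := by
    intro τ
    have e : ∀ φ, f (τ + φ, 2 * π - τ) = f (φ, τ) := by
      intro φ
      have e1 : cos (2 * (2 * π - τ)) = cos (2 * τ) := by
        rw [show 2 * (2 * π - τ) = -(2 * τ) + 2 * π + 2 * π by ring, cos_add_two_pi,
          cos_add_two_pi, cos_neg]
      have e2 : p (τ + φ + (2 * π - τ)) = p φ := by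
        rw [show τ + φ + (2 * π - τ) = φ + 2 * π by ring, hper φ]
      simp only [hf, e1, e2]; rw [add_comm τ φ]; ring
    have hg : Function.Periodic (fun φ => f (φ, 2 * π - τ)) (2 * π) := by
      intro φ
      have e : φ + 2 * π + (2 * π - τ) = φ + (2 * π - τ) + 2 * π := by ring
      simp only [hf, e, hper _]
    have := integral_shift hg τ
    simp only [e] at this
    exact this.symm
  have hhalf : ∫ τ in π..2 * π, k τ = ∫ τ in (0 : ℝ)..π, k τ := by
    have := intervalIntegral.integral_comp_sub_left (a := 0) (b := π) k (2 * π)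
    simp only [hsymm] at this
    rw [this]; congr 1 <;> ring
  have hfull : ∫ τ in (0 : ℝ)..2 * π, k τ = 2 * ∫ τ in (0 : ℝ)..π, k τ := by
    rw [← intervalIntegral.integral_add_adjacent_intervals (hkc.intervalIntegrable 0 π)
      (hkc.intervalIntegrable π (2 * π)), hhalf]; ring
  have h1 : ∫ φ in (0 : ℝ)..2 * π, ∫ τ in (0 : ℝ)..π, f (φ, τ) =
      1 / 2 * ∫ φ in (0 : ℝ)..2 * π, ∫ τ in (0 : ℝ)..2 * π, f (φ, τ) := by
    rw [intervalIntegral_swap hfc two_pi_pos.le pi_pos.le,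
      intervalIntegral_swap hfc two_pi_pos.le two_pi_pos.le]
    change ∫ τ in (0 : ℝ)..π, k τ = 1 / 2 * ∫ τ in (0 : ℝ)..2 * π, k τ
    rw [hfull]; ring
  set L := ∫ φ in (0 : ℝ)..2 * π, p φ with hL
  set C := ∫ φ in (0 : ℝ)..2 * π, p φ * cos (2 * φ) with hC
  set S := ∫ φ in (0 : ℝ)..2 * π, p φ * sin (2 * φ) with hS
  -- Over a full period ψ = φ + τ becomes a free variable, and cos 2(ψ - φ) separates. Only
  -- harmonics of order 0 and 2 survive.
  have hinner : ∀ φ, ∫ τ in (0 : ℝ)..2 * π, f (φ, τ) =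
      3 / 2 * L * p φ + 9 / 2 * C * (p φ * cos (2 * φ)) + 9 / 2 * S * (p φ * sin (2 * φ)) := by
    intro φ
    set g : ℝ → ℝ := fun ψ => 3 / 2 * p φ * p ψ +
      9 / 2 * (p φ * cos (2 * φ)) * (p ψ * cos (2 * ψ)) +
      9 / 2 * (p φ * sin (2 * φ)) * (p ψ * sin (2 * ψ)) with hg
    have hgp : Function.Periodic g (2 * π) := by
      intro ψ
      have e : 2 * (ψ + 2 * π) = 2 * ψ + 2 * π + 2 * π := by ring
      simp only [hg, hper ψ, e, cos_add_two_pi, sin_add_two_pi]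
    have e : ∀ τ, f (φ, τ) = g (φ + τ) := by
      intro τ
      have e1 : cos (2 * τ) = cos (2 * (φ + τ)) * cos (2 * φ) + sin (2 * (φ + τ)) * sin (2 * φ) := by
        rw [← cos_sub]; congr 1; ring
      simp only [hf, hg, e1]; ring
    simp only [e]
    rw [integral_shift hgp, hg]
    rw [intervalIntegral.integral_add (by apply Continuous.intervalIntegrable; fun_prop)
      (by apply Continuous.intervalIntegrable; fun_prop),
      intervalIntegral.integral_add (by apply Continuous.intervalIntegrable; fun_prop)
      (by apply Continuous.intervalIntegrable; fun_prop)]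
    simp only [intervalIntegral.integral_const_mul]
    ring
  change ∫ φ in (0 : ℝ)..2 * π, ∫ τ in (0 : ℝ)..π, f (φ, τ) = _
  rw [h1]
  simp only [hinner]
  rw [intervalIntegral.integral_add (by apply Continuous.intervalIntegrable; fun_prop)
      (by apply Continuous.intervalIntegrable; fun_prop),
      intervalIntegral.integral_add (by apply Continuous.intervalIntegrable; fun_prop)
      (by apply Continuous.intervalIntegrable; fun_prop)]
  simp only [intervalIntegral.integral_const_mul]
  ring

/-- The product of the two tangent lengths and `sin² τ`, integrated over all pairs of support
lines. -/
theorem integral_tangent_product (hp : ∀ x, HasDerivAt p (q x) x) (hq : ∀ x, HasDerivAt q (r x) x)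
    (hr : Continuous r) (hper : Function.Periodic p (2 * π))
    (hqper : Function.Periodic q (2 * π)) :
    ∫ φ in (0 : ℝ)..2 * π, ∫ τ in (0 : ℝ)..π,
      (p (φ + τ) - p φ * cos τ - q φ * sin τ) * (p φ - p (φ + τ) * cos τ + q (φ + τ) * sin τ) =
    3 / 4 * (∫ φ in (0 : ℝ)..2 * π, p φ) ^ 2 +
      9 / 4 * ((∫ φ in (0 : ℝ)..2 * π, p φ * cos (2 * φ)) ^ 2 +
        (∫ φ in (0 : ℝ)..2 * π, p φ * sin (2 * φ)) ^ 2) := by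
  have hpc : Continuous p := continuous_iff_continuousAt.2 fun x => (hp x).continuousAt
  have hqc : Continuous q := continuous_iff_continuousAt.2 fun x => (hq x).continuousAt
  -- `A'` is a derivative in τ of an expression each of whose terms contains sin τ, so it integrates
  -- to zero over [0, π]. `B'` is a derivative in φ of a periodic expression. Modulo both, the
  -- integrand is the autocorrelation kernel (`hE`).
  set A' : ℝ × ℝ → ℝ := fun x =>
    2 * (sin x.2 * cos x.2) * (p x.1 * q (x.1 + x.2)) + sin x.2 ^ 2 * (p x.1 * r (x.1 + x.2)) -
    (4 * (cos x.2 ^ 2 - sin x.2 ^ 2) * (p x.1 * p (x.1 + x.2)) +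
      4 * (cos x.2 * sin x.2) * (p x.1 * q (x.1 + x.2))) -
    (cos x.2 * (p x.1 ^ 2 + p (x.1 + x.2) ^ 2) +
      sin x.2 * (2 * p (x.1 + x.2) * q (x.1 + x.2))) with hA'
  set B' : ℝ × ℝ → ℝ := fun x =>
    -(sin x.2 ^ 2 * (q x.1 * q (x.1 + x.2) + p x.1 * r (x.1 + x.2))) +
    cos x.2 * sin x.2 * (q x.1 * p (x.1 + x.2) + p x.1 * q (x.1 + x.2)) +
    sin x.2 * (3 * p (x.1 + x.2) * q (x.1 + x.2) - p x.1 * q x.1) with hB'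
  have hA'c : Continuous A' := by fun_prop
  have hB'c : Continuous B' := by fun_prop
  have hA : ∀ φ, ∫ τ in (0 : ℝ)..π, A' (φ, τ) = 0 := by
    intro φ
    refine integral_deriv_eq_zero (g := fun τ => sin τ ^ 2 * (p φ * q (φ + τ)) -
      4 * (cos τ * sin τ) * (p φ * p (φ + τ)) - sin τ * (p φ ^ 2 + p (φ + τ) ^ 2))
      (fun τ => ?_) (by fun_prop) (by simp)
    have d1 : HasDerivAt (fun τ => p (φ + τ)) (q (φ + τ)) τ := (hp (φ + τ)).comp_const_add φ τ
    have d2 : HasDerivAt (fun τ => q (φ + τ)) (r (φ + τ)) τ := (hq (φ + τ)).comp_const_add φ τ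
    have ds := hasDerivAt_sin τ
    have dc := hasDerivAt_cos τ
    refine ((((ds.pow 2).mul (d2.const_mul (p φ))).sub
      (((dc.mul ds).const_mul 4).mul (d1.const_mul (p φ)))).sub
      (ds.mul ((d1.pow 2).const_add (p φ ^ 2)))).congr_deriv ?_
    simp only [hA', Pi.mul_apply, Pi.pow_apply]
    push_cast
    ring
  have hB : ∀ τ, ∫ φ in (0 : ℝ)..2 * π, B' (φ, τ) = 0 := by
    intro τ
    refine integral_deriv_eq_zero (g := fun φ => -(sin τ ^ 2 * (p φ * q (φ + τ))) +
      cos τ * sin τ * (p φ * p (φ + τ)) + sin τ * (3 / 2 * p (φ + τ) ^ 2 - 1 / 2 * p φ ^ 2))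
      (fun φ => ?_) (by fun_prop) ?_
    · have d1 : HasDerivAt (fun φ => p (φ + τ)) (q (φ + τ)) φ := (hp (φ + τ)).comp_add_const φ τ
      have d2 : HasDerivAt (fun φ => q (φ + τ)) (r (φ + τ)) φ := (hq (φ + τ)).comp_add_const φ τ
      refine (((((hp φ).mul d2).const_mul (sin τ ^ 2)).neg.add
        (((hp φ).mul d1).const_mul (cos τ * sin τ))).add
        ((((d1.pow 2).const_mul (3 / 2)).sub
          (((hp φ).pow 2).const_mul (1 / 2))).const_mul (sin τ))).congr_deriv ?_
      simp only [hB']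
      push_cast
      ring
    · have e1 : p (2 * π) = p 0 := by simpa using hper 0
      have e2 : p (2 * π + τ) = p (0 + τ) := by rw [add_comm, hper, zero_add]
      have e3 : q (2 * π + τ) = q (0 + τ) := by rw [add_comm, hqper, zero_add]
      simp only [e1, e2, e3]
  have hE : ∀ φ τ, (p (φ + τ) - p φ * cos τ - q φ * sin τ) *
      (p φ - p (φ + τ) * cos τ + q (φ + τ) * sin τ) =
      (3 / 2 + 9 / 2 * cos (2 * τ)) * (p φ * p (φ + τ)) + A' (φ, τ) + B' (φ, τ) := by
    intro φ τ
    simp only [hA', hB', cos_two_mul]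
    linear_combination (-4 * p φ * p (φ + τ)) * sin_sq_add_cos_sq τ
  have h3 : ∀ φ, ∫ τ in (0 : ℝ)..π, (p (φ + τ) - p φ * cos τ - q φ * sin τ) *
      (p φ - p (φ + τ) * cos τ + q (φ + τ) * sin τ) =
      (∫ τ in (0 : ℝ)..π, (3 / 2 + 9 / 2 * cos (2 * τ)) * (p φ * p (φ + τ))) +
      ∫ τ in (0 : ℝ)..π, B' (φ, τ) := by
    intro φ
    simp only [hE]
    rw [intervalIntegral.integral_add (by apply Continuous.intervalIntegrable; fun_prop)
      (by apply Continuous.intervalIntegrable; fun_prop),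
      intervalIntegral.integral_add (by apply Continuous.intervalIntegrable; fun_prop)
      (by apply Continuous.intervalIntegrable; fun_prop), hA, add_zero]
  simp only [h3]
  rw [intervalIntegral.integral_add, integral_autocorrelation hpc hper,
    intervalIntegral_swap hB'c two_pi_pos.le pi_pos.le]
  · simp [hB]
  · apply Continuous.intervalIntegrable
    exact intervalIntegral.continuous_parametric_intervalIntegral_of_continuous'
      (f := fun φ τ => (3 / 2 + 9 / 2 * cos (2 * τ)) * (p φ * p (φ + τ))) (by fun_prop) 0 π
  · apply Continuous.intervalIntegrable
    exact intervalIntegral.continuous_parametric_intervalIntegral_of_continuous'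
      (f := fun φ τ => B' (φ, τ)) (by fun_prop) 0 π

end TangentProduct

/-! ### The integral of `sin³ ω` -/

theorem hasFDerivAt_smul_columns {f : ℝ × ℝ → ℝ} {V : ℝ × ℝ → Plane} {x : ℝ × ℝ} {f1 f2 : ℝ}
    {v1 v2 : Plane} (hf : HasFDerivAt f (f1 • ContinuousLinearMap.fst ℝ ℝ ℝ +
      f2 • ContinuousLinearMap.snd ℝ ℝ ℝ) x) (hV : HasFDerivAt V (columns v1 v2) x) :
    HasFDerivAt (fun y => f y • V y) (columns (f1 • V x + f x • v1) (f2 • V x + f x • v2)) x := by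
  refine (hf.smul hV).congr_fderiv ?_
  refine ContinuousLinearMap.ext fun y => ?_
  simp [columns_apply]
  module

theorem hasFDerivAt_comp_fst {V : ℝ → Plane} {V' : Plane} {x : ℝ × ℝ} (hV : HasDerivAt V V' x.1) :
    HasFDerivAt (fun y : ℝ × ℝ => V y.1) (columns V' 0) x := by
  refine (hV.hasFDerivAt.comp x hasFDerivAt_fst).congr_fderiv ?_
  refine ContinuousLinearMap.ext fun y => ?_
  simp [columns_apply]

theorem hasFDerivAt_fst_real {f : ℝ → ℝ} {f' : ℝ} {x : ℝ × ℝ} (hf : HasDerivAt f f' x.1) :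
    HasFDerivAt (fun y : ℝ × ℝ => f y.1) (f' • ContinuousLinearMap.fst ℝ ℝ ℝ +
      (0 : ℝ) • ContinuousLinearMap.snd ℝ ℝ ℝ) x := by
  refine (hf.comp_hasFDerivAt x hasFDerivAt_fst).congr_fderiv ?_
  simp

theorem hasFDerivAt_snd_real {f : ℝ → ℝ} {f' : ℝ} {x : ℝ × ℝ} (hf : HasDerivAt f f' x.2) :
    HasFDerivAt (fun y : ℝ × ℝ => f y.2) (f' • ContinuousLinearMap.snd ℝ ℝ ℝ) x :=
  hf.comp_hasFDerivAt x hasFDerivAt_snd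

theorem columns_add (u v u' v' : Plane) :
    columns u v + columns u' v' = columns (u + u') (v + v') := by
  refine ContinuousLinearMap.ext fun y => ?_
  simp [columns_apply]
  module

namespace IsSmoothBody

variable {K : Set Plane} (hK : IsSmoothBody K)
include hK

/-- The second column is parallel to `N' φ`, so the coefficient b does not affect the Jacobian and
may stay unspecified. -/
theorem hasFDerivAt_corner {φ τ : ℝ} (h0 : 0 < τ) (h1 : τ < π) : ∃ b : ℝ,
    HasFDerivAt (corner K) (columns (-tangentLeft K φ τ • N φ + b • N' φ)
      ((tangentRight K φ τ / sin τ) • N' φ)) (φ, τ) := by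
  have hs := sin_ne_zero_of_Ioo h0 h1
  have d1 : HasFDerivAt (fun x : ℝ × ℝ => supp K x.1) _ (φ, τ) :=
    hasFDerivAt_fst_real (hK.hasDerivAt_supp φ)
  have dsum : HasFDerivAt (fun x : ℝ × ℝ => x.1 + x.2)
      (ContinuousLinearMap.fst ℝ ℝ ℝ + ContinuousLinearMap.snd ℝ ℝ ℝ) (φ, τ) :=
    hasFDerivAt_fst.add hasFDerivAt_snd
  have d2 : HasFDerivAt (fun x : ℝ × ℝ => supp K (x.1 + x.2)) _ (φ, τ) :=
    HasDerivAt.comp_hasFDerivAt (f := fun x : ℝ × ℝ => x.1 + x.2) (φ, τ)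
      (hK.hasDerivAt_supp (φ + τ)) dsum
  have dc : HasFDerivAt (fun x : ℝ × ℝ => cos x.2) _ (φ, τ) :=
    hasFDerivAt_snd_real (hasDerivAt_cos τ)
  have ds : HasFDerivAt (fun x : ℝ × ℝ => (sin x.2)⁻¹) _ (φ, τ) :=
    hasFDerivAt_snd_real (f := fun t => (sin t)⁻¹) ((hasDerivAt_sin τ).inv hs)
  have dm : HasFDerivAt (fun x : ℝ × ℝ => (supp K (x.1 + x.2) - supp K x.1 * cos x.2) / sin x.2)
      (((deriv (supp K) (φ + τ) - deriv (supp K) φ * cos τ) / sin τ) •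
        ContinuousLinearMap.fst ℝ ℝ ℝ +
      (tangentRight K φ τ / sin τ) • ContinuousLinearMap.snd ℝ ℝ ℝ) (φ, τ) := by
    simp only [div_eq_mul_inv]
    refine ((d2.sub (d1.mul dc)).mul ds).congr_fderiv ?_
    have hsc := sin_sq_add_cos_sq τ
    apply ContinuousLinearMap.ext
    rintro ⟨x, y⟩
    simp [tangentRight]
    field_simp
    linear_combination (supp K φ * y) * hsc
  have hd := (hasFDerivAt_smul_columns d1 (hasFDerivAt_comp_fst (hasDerivAt_N φ))).add
    (hasFDerivAt_smul_columns dm (hasFDerivAt_comp_fst (hasDerivAt_N' φ)))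
  rw [columns_add] at hd
  refine ⟨supp K φ + (deriv (supp K) (φ + τ) - deriv (supp K) φ * cos τ) / sin τ,
    hd.congr_fderiv ?_⟩
  congr 1
  · have : tangentLeft K φ τ =
        (supp K (φ + τ) - supp K φ * cos τ) / sin τ - deriv (supp K) φ := by
      rw [tangentLeft]; field_simp
    rw [this]
    module
  · simp

omit hK in
theorem cross_columns (a b c : ℝ) (φ : ℝ) : cross (a • N φ + b • N' φ) (c • N' φ) = a * c := by
  simp [cross]
  linear_combination (a * c) * sin_sq_add_cos_sq φ

/-- The integral of `sin³ ω` over the exterior of a smooth convex body. -/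
theorem integral_sin_visualAngle_cubed :
    IntegrableOn (fun P => sin (visualAngle K P) ^ 3) Kᶜ ∧
    ∫ P in Kᶜ, sin (visualAngle K P) ^ 3 =
      3 / 4 * (∫ φ in (0 : ℝ)..2 * π, supp K φ) ^ 2 +
      9 / 4 * ((∫ φ in (0 : ℝ)..2 * π, supp K φ * cos (2 * φ)) ^ 2 +
        (∫ φ in (0 : ℝ)..2 * π, supp K φ * sin (2 * φ)) ^ 2) := by
  have hS : MeasurableSet cornerDomain := measurableSet_Ico.prod measurableSet_Ioo
  -- The coefficient must be a total function of the parameters; outside the domain it is set to 0.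
  have hex : ∀ x : ℝ × ℝ, ∃ b : ℝ, x ∈ cornerDomain → HasFDerivWithinAt (corner K)
      (columns (-tangentLeft K x.1 x.2 • N x.1 + b • N' x.1)
        ((tangentRight K x.1 x.2 / sin x.2) • N' x.1)) cornerDomain x := by
    rintro ⟨φ, τ⟩
    by_cases hx : (φ, τ) ∈ cornerDomain
    · obtain ⟨b, hb⟩ := hK.hasFDerivAt_corner (φ := φ) hx.2.1 hx.2.2
      exact ⟨b, fun _ => hb.hasFDerivWithinAt⟩
    · exact ⟨0, fun h => absurd h hx⟩
  choose b hb using hex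
  set E : ℝ × ℝ → ℝ := fun x =>
    (supp K (x.1 + x.2) - supp K x.1 * cos x.2 - deriv (supp K) x.1 * sin x.2) *
    (supp K x.1 - supp K (x.1 + x.2) * cos x.2 + deriv (supp K) (x.1 + x.2) * sin x.2) with hE
  have hEc : Continuous E := by
    have h1 := hK.continuous_supp
    have h2 := hK.continuous_deriv
    fun_prop
  -- The factor sin³ τ cancels the three denominators, one from each tangent length and one from the
  -- Jacobian. The remaining integrand `E` is continuous on the closed rectangle.
  have hEq : Set.EqOn (fun x : ℝ × ℝ => |cross (-tangentLeft K x.1 x.2 • N x.1 + b x • N' x.1)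
        ((tangentRight K x.1 x.2 / sin x.2) • N' x.1)| * sin (visualAngle K (corner K x)) ^ 3)
      E cornerDomain := by
    rintro ⟨φ, τ⟩ ⟨-, hτ⟩
    have hs := sin_pos_of_mem_Ioo hτ
    simp only
    rw [cross_columns, (isCorner_corner K hτ.1 hτ.2).visualAngle_eq hK, sin_pi_sub, neg_mul,
      abs_neg, abs_of_pos (mul_pos (hK.tangentLeft_pos hτ.1 hτ.2)
        (div_pos (hK.tangentRight_pos hτ.1 hτ.2) hs)), tangentLeft, tangentRight]
    simp only [hE]
    field_simp
  have hR := setIntegral_rectangle hEc two_pi_pos.le pi_pos.le Ico_ae_eq_Ioc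
    (Ioo_ae_eq_Ioc (a := 0) (b := π) (μ := volume))
  rw [← hK.image_corner]
  constructor
  · rw [integrableOn_image_iff hS (fun x hx => hb x hx) hK.injOn_corner]
    exact (integrableOn_congr_fun hEq hS).2 hR.1
  · rw [setIntegral_image_eq hS (fun x hx => hb x hx) hK.injOn_corner, setIntegral_congr_fun hS hEq]
    refine hR.2.trans ?_
    exact integral_tangent_product hK.hasDerivAt_supp hK.hasDerivAt_deriv hK.continuous_deriv2
      (supp_periodic K) (deriv_periodic (supp_periodic K))

end IsSmoothBody

/-! ### Areas of star-shaped regions -/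

/-- The parameters of the points of a star-shaped region other than its centre. -/
def starDomain : Set (ℝ × ℝ) := Set.Ico 0 (2 * π) ×ˢ Set.Ioc 0 1

/-- The area of a region swept by the segments from `c` to the points of a closed curve. -/
theorem area_star {β β' : ℝ → Plane} (c : Plane) (hβ : ∀ φ, HasDerivAt β (β' φ) φ)
    (hβ' : Continuous β') (hcross : ∀ φ, 0 ≤ cross (β φ) (β' φ))
    (hinj : starDomain.InjOn fun x : ℝ × ℝ => c + x.2 • β x.1) :
    volume.real (insert c ((fun x : ℝ × ℝ => c + x.2 • β x.1) '' starDomain)) =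
      1 / 2 * ∫ φ in (0 : ℝ)..2 * π, cross (β φ) (β' φ) := by
  have hS : MeasurableSet starDomain := measurableSet_Ico.prod measurableSet_Ioc
  have hβc : Continuous β := continuous_iff_continuousAt.2 fun φ => (hβ φ).continuousAt
  have hd : ∀ x ∈ starDomain, HasFDerivWithinAt (fun x : ℝ × ℝ => c + x.2 • β x.1)
      (columns (x.2 • β' x.1) (β x.1)) starDomain x := by
    intro x _
    have h2 : HasFDerivAt (fun y : ℝ × ℝ => y.2) ((0 : ℝ) • ContinuousLinearMap.fst ℝ ℝ ℝ +
      (1 : ℝ) • ContinuousLinearMap.snd ℝ ℝ ℝ) x := hasFDerivAt_snd.congr_fderiv (by simp)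
    have := (hasFDerivAt_smul_columns h2 (hasFDerivAt_comp_fst (hβ x.1))).const_add c
    refine (this.congr_fderiv ?_).hasFDerivWithinAt
    simp
  have hc1 : Continuous fun x : ℝ × ℝ => x.2 * cross (β x.1) (β' x.1) := by
    simp only [cross]; fun_prop
  have h1 : volume.real ((fun x : ℝ × ℝ => c + x.2 • β x.1) '' starDomain) =
      ∫ P in (fun x : ℝ × ℝ => c + x.2 • β x.1) '' starDomain, (1 : ℝ) := by simp
  -- The centre is a null set. The Jacobian is t times the cross product, up to sign, and the
  -- integral of t over (0, 1] gives the factor 1/2.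
  rw [measureReal_congr (insert_ae_eq_self _ _), h1, setIntegral_image_eq hS hd hinj,
    setIntegral_congr_fun (g := fun x : ℝ × ℝ => x.2 * cross (β x.1) (β' x.1)) hS]
  · refine (setIntegral_rectangle hc1 two_pi_pos.le zero_le_one Ico_ae_eq_Ioc
      Filter.EventuallyEq.rfl).2.trans ?_
    simp only [intervalIntegral.integral_mul_const, integral_id]
    rw [intervalIntegral.integral_const_mul]
    norm_num
  · rintro ⟨φ, t⟩ ⟨-, ht⟩
    have : cross (t • β' φ) (β φ) = -(t * cross (β φ) (β' φ)) := by
      simp [cross]; ring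
    simp only [this, abs_neg, mul_one]
    exact abs_of_nonneg (mul_nonneg ht.1.le (hcross φ))

theorem intervalIntegral_apply {f : ℝ → Plane} (hf : Continuous f) (a b : ℝ) (i : Fin 2) :
    (∫ x in a..b, f x) i = ∫ x in a..b, f x i :=
  ((EuclideanSpace.proj (𝕜 := ℝ) i).intervalIntegral_comp_comm
    (hf.intervalIntegrable a b)).symm

theorem N_ne_N {φ ψ : ℝ} (hφ : φ ∈ Set.Ico 0 (2 * π)) (hψ : ψ ∈ Set.Ico 0 (2 * π))
    (hne : φ ≠ ψ) : N φ ≠ N ψ := by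
  intro h
  have hc : cos φ = cos ψ := congrFun (congrArg WithLp.ofLp h) 0
  have hs : sin φ = sin ψ := congrFun (congrArg WithLp.ofLp h) 1
  have hz : (φ : Real.Angle) = ψ := Real.Angle.cos_sin_inj hc hs
  rw [Real.Angle.angle_eq_iff_two_pi_dvd_sub] at hz
  obtain ⟨k, hk⟩ := hz
  have hp := two_pi_pos
  have k1 : (k : ℝ) < 1 := by
    by_contra! h; nlinarith [hφ.2, hψ.1]
  have k2 : (-1 : ℝ) < k := by
    by_contra! h; nlinarith [hφ.1, hψ.2]
  have : k = 0 := by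
    have a : k < 1 := by exact_mod_cast k1
    have b : -1 < k := by exact_mod_cast k2
    omega
  rw [this] at hk
  apply hne
  simp at hk
  linarith

/-! ### Steiner point, area, pedal area and perimeter. -/

namespace IsSmoothBody

variable {K : Set Plane} (hK : IsSmoothBody K)
include hK

theorem continuous_smul_N : Continuous fun φ => supp K φ • N φ :=
  hK.continuous_supp.smul
    (continuous_iff_continuousAt.2 fun φ => (hasDerivAt_N φ).continuousAt)

theorem steinerPoint_zero :
    steinerPoint K 0 = 1 / π * ∫ φ in (0 : ℝ)..2 * π, supp K φ * cos φ := by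
  rw [steinerPoint, PiLp.smul_apply, intervalIntegral_apply hK.continuous_smul_N]
  simp

theorem steinerPoint_one :
    steinerPoint K 1 = 1 / π * ∫ φ in (0 : ℝ)..2 * π, supp K φ * sin φ := by
  rw [steinerPoint, PiLp.smul_apply, intervalIntegral_apply hK.continuous_smul_N]
  simp

/-- The Steiner point lies in the interior of the body. -/
theorem inner_steinerPoint_lt (ψ : ℝ) : inner ℝ (steinerPoint K) (N ψ) < supp K ψ := by
  have hpc := hK.continuous_supp
  have hqc := hK.continuous_deriv
  -- Integration by parts identifies the Steiner point with the mean of the boundary curve over the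
  -- normal angle. So the integral over φ of this nonnegative gap is 2π times the gap at the Steiner
  -- point; it is positive because the gap is positive at φ = ψ + π.
  set F : ℝ → ℝ := fun φ => supp K ψ - inner ℝ (boundary K φ) (N ψ) with hF
  have hFc : Continuous F := by
    simp only [hF, inner_boundary]; fun_prop
  have hFp : Function.Periodic F (2 * π) := fun φ => by simp only [hF, boundary_periodic φ]
  have hpos : 0 < ∫ φ in (0 : ℝ)..2 * π, F φ := by
    rw [← integral_shift hFp ψ]
    refine intervalIntegral.integral_pos two_pi_pos (by fun_prop)
      (fun x _ => sub_nonneg.2 (hK.inner_boundary_le _ _)) ⟨π, ⟨pi_pos.le, by linarith [pi_pos]⟩, ?_⟩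
    have h := hK.supp_add_pi_pos ψ
    have h1 := hK.pull_back_lt (φ := ψ) pi_pos.ne' (by linarith [pi_pos]) le_rfl
    simp only [hF, inner_boundary, sub_add_cancel_left, cos_neg, sin_neg, cos_pi, sin_pi] at h1 ⊢
    linarith
  have hparts : ∫ φ in (0 : ℝ)..2 * π,
      (deriv (supp K) φ * sin (ψ - φ) - supp K φ * cos (ψ - φ)) = 0 := by
    refine integral_deriv_eq_zero (g := fun φ => supp K φ * sin (ψ - φ)) (fun φ => ?_)
      (by fun_prop) ?_
    · refine ((hK.hasDerivAt_supp φ).mul ((hasDerivAt_id φ).const_sub ψ).sin).congr_deriv ?_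
      simp; ring
    · have : supp K (2 * π) = supp K 0 := by simpa using supp_periodic K 0
      simp [this]
  have hst : inner ℝ (steinerPoint K) (N ψ) =
      1 / π * ∫ φ in (0 : ℝ)..2 * π, supp K φ * cos (ψ - φ) := by
    rw [inner_N, hK.steinerPoint_zero, hK.steinerPoint_one, mul_assoc, mul_assoc, ← mul_add,
      ← intervalIntegral.integral_mul_const, ← intervalIntegral.integral_mul_const,
      ← intervalIntegral.integral_add (by apply Continuous.intervalIntegrable; fun_prop)
        (by apply Continuous.intervalIntegrable; fun_prop)]
    congr 1
    apply intervalIntegral.integral_congr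
    intro φ _
    simp only [cos_sub]; ring
  have e : ∫ φ in (0 : ℝ)..2 * π, F φ =
      2 * π * supp K ψ - 2 * ∫ φ in (0 : ℝ)..2 * π, supp K φ * cos (ψ - φ) := by
    have : ∀ φ, F φ = supp K ψ - 2 * (supp K φ * cos (ψ - φ)) -
        (deriv (supp K) φ * sin (ψ - φ) - supp K φ * cos (ψ - φ)) := fun φ => by
      simp only [hF, inner_boundary]; ring
    simp only [this]
    rw [intervalIntegral.integral_sub (by apply Continuous.intervalIntegrable; fun_prop)
      (by apply Continuous.intervalIntegrable; fun_prop), hparts,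
      intervalIntegral.integral_sub (by apply Continuous.intervalIntegrable; fun_prop)
      (by apply Continuous.intervalIntegrable; fun_prop)]
    simp
  rw [e] at hpos
  rw [hst, one_div, inv_mul_lt_iff₀ pi_pos]
  linarith

/-- K is star-shaped about the interior point c with the boundary curve as its rim, so `area_star`
applies with Jacobian (p + p'')(p - ⟨c, N⟩). -/
theorem area_eq_of_center {c : Plane} (hc : ∀ ψ, inner ℝ c (N ψ) < supp K ψ) :
    area K = 1 / 2 * ∫ φ in (0 : ℝ)..2 * π, curvRadius K φ * (supp K φ - inner ℝ c (N φ)) := by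
  have hcK : c ∈ K := hK.mem_iff.2 fun ψ => (hc ψ).le
  have himg : K = insert c ((fun x : ℝ × ℝ => c + x.2 • (boundary K x.1 - c)) '' starDomain) := by
    ext x
    simp only [Set.mem_insert_iff, Set.mem_image]
    constructor
    · intro hx
      by_cases hxc : x = c
      · exact .inl hxc
      right
      -- The maximum of this quotient is the gauge of x about c. Dividing x - c by it gives a point
      -- of K on the support line at a maximizing angle b, hence the boundary point there.
      set F : ℝ → ℝ := fun φ => inner ℝ (x - c) (N φ) / (supp K φ - inner ℝ c (N φ)) with hF
      have hq : ∀ φ, 0 < supp K φ - inner ℝ c (N φ) := fun φ => sub_pos.2 (hc φ)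
      have hFc : Continuous F := by
        have := hK.continuous_supp
        refine Continuous.div ?_ ?_ fun φ => (hq φ).ne'
        · simp only [inner_N]; fun_prop
        · simp only [inner_N]; fun_prop
      have hFp : Function.Periodic F (2 * π) := fun φ => by
        simp only [hF, N_add_two_pi, supp_periodic K φ]
      obtain ⟨a, -, ha⟩ := isCompact_Icc.exists_isMaxOn (s := Set.Icc 0 (2 * π))
        (Set.nonempty_Icc.2 two_pi_pos.le) hFc.continuousOn
      obtain ⟨b, hb, hab⟩ := hFp.exists_mem_Ico two_pi_pos a 0
      rw [zero_add] at hb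
      have hmax : ∀ φ, F φ ≤ F b := fun φ => by
        obtain ⟨φ', hφ', h⟩ := hFp.exists_mem_Ico two_pi_pos φ 0
        rw [zero_add] at hφ'
        rw [h, ← hab]
        exact ha (Set.Ico_subset_Icc_self hφ')
      have hsub : ∀ y z : Plane, ∀ φ, inner ℝ (y - z) (N φ) = inner ℝ y (N φ) - inner ℝ z (N φ) :=
        fun y z φ => inner_sub_left _ _ _
      have hpos : 0 < F b := by
        obtain ⟨θ, hθ⟩ := exists_eq_smul_N (x - c)
        refine lt_of_lt_of_le (div_pos ?_ (hq θ)) (hmax θ)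
        have hn : 0 < ‖x - c‖ := norm_pos_iff.2 (sub_ne_zero.2 hxc)
        rw [hθ, inner_smul_left, inner_eq, N_zero, N_one]
        have := sin_sq_add_cos_sq θ
        simp
        nlinarith
      have hle : F b ≤ 1 := by
        rw [hF]; simp only
        rw [div_le_one (hq b), hsub]
        linarith [hK.inner_le hx b]
      have hin : ∀ φ, inner ℝ (c + (F b)⁻¹ • (x - c)) (N φ) =
          inner ℝ c (N φ) + (F b)⁻¹ * inner ℝ (x - c) (N φ) := fun φ => by
        rw [inner_add_left, inner_smul_left]; simp
      have hy : c + (F b)⁻¹ • (x - c) = boundary K b := by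
        apply hK.eq_boundary
        · rw [hK.mem_iff]
          intro φ
          have h1 := hmax φ
          simp only [hF] at h1
          rw [div_le_iff₀ (hq φ)] at h1
          have h2 : (F b)⁻¹ * inner ℝ (x - c) (N φ) ≤ supp K φ - inner ℝ c (N φ) := by
            rw [inv_mul_le_iff₀ hpos]; exact h1
          rw [hin]; linarith
        · have h1 : inner ℝ (x - c) (N b) = F b * (supp K b - inner ℝ c (N b)) := by
            simp only [hF]; rw [div_mul_cancel₀ _ (hq b).ne']
          rw [hin, h1, inv_mul_cancel_left₀ hpos.ne']; ring
      refine ⟨(b, F b), ⟨hb, hpos, hle⟩, ?_⟩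
      simp only [← hy, add_sub_cancel_left, smul_smul, mul_inv_cancel₀ hpos.ne', one_smul]
      abel
    · rintro (rfl | ⟨⟨φ, t⟩, ⟨-, ht⟩, rfl⟩)
      · exact hcK
      · have := hK.convex hcK (hK.boundary_mem φ) (sub_nonneg.2 ht.2) ht.1.le (by ring)
        convert this using 1
        simp only; module
  have hcr : ∀ φ, cross (boundary K φ - c) (curvRadius K φ • N' φ) =
      curvRadius K φ * (supp K φ - inner ℝ c (N φ)) := fun φ => by
    rw [← inner_boundary_self (K := K) φ]
    simp only [cross, inner_N, PiLp.sub_apply, PiLp.smul_apply, N'_zero, N'_one, smul_eq_mul]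
    ring
  rw [area, himg, area_star c (fun φ => (hK.hasDerivAt_boundary φ).sub_const c)
    (hK.continuous_curvRadius.smul
      (continuous_iff_continuousAt.2 fun φ => (hasDerivAt_N' φ).continuousAt))]
  · rw [← himg]; simp only [hcr]
  · intro φ
    rw [hcr]
    exact mul_nonneg (hK.curvRadius_pos φ).le (sub_pos.2 (hc φ)).le
  -- Pairing with `N ψ` when s ≤ t forces the boundary point at φ up to the support line at ψ, which
  -- strict convexity allows only for φ = ψ.
  · have key : ∀ φ ∈ Set.Ico 0 (2 * π), ∀ ψ ∈ Set.Ico 0 (2 * π), ∀ s t : ℝ, 0 < s → s ≤ t →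
        s • (boundary K φ - c) = t • (boundary K ψ - c) → φ = ψ ∧ s = t := by
      intro φ hφ ψ hψ s t hs hst h
      have h1 := congrArg (fun v => inner ℝ v (N ψ)) h
      simp only [inner_smul_left, inner_sub_left, inner_boundary_self] at h1
      simp only [conj_trivial] at h1
      have hqψ := sub_pos.2 (hc ψ)
      have h2 := hK.inner_boundary_le φ ψ
      have h3 : ¬ inner ℝ (boundary K φ) (N ψ) < supp K ψ := fun hlt => by nlinarith
      have hφψ : φ = ψ := by
        by_contra hne
        apply h3
        rcases lt_or_gt_of_ne hne with hlt | hlt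
        · exact hK.inner_boundary_lt hlt (by linarith [hφ.1, hψ.2])
        · have := hK.inner_boundary_lt (φ := φ) (ψ := ψ + 2 * π) (by linarith [hφ.2, hψ.1])
            (by linarith)
          rwa [N_add_two_pi, supp_periodic] at this
      subst hφψ
      refine ⟨rfl, ?_⟩
      rw [inner_boundary_self] at h1
      exact mul_right_cancel₀ hqψ.ne' h1
    rintro ⟨φ, s⟩ ⟨hφ, hs⟩ ⟨ψ, t⟩ ⟨hψ, ht⟩ h
    have h' : s • (boundary K φ - c) = t • (boundary K ψ - c) := add_left_cancel h
    rcases le_total s t with hst | hst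
    · obtain ⟨rfl, rfl⟩ := key φ hφ ψ hψ s t hs.1 hst h'; rfl
    · obtain ⟨rfl, rfl⟩ := key ψ hψ φ hφ t s ht.1 hst h'.symm; rfl

/-- About the Steiner point the pedal curve has polar equation r = q(φ), where q is the distance to
the support line. Positivity of q makes the polar parametrization injective. -/
theorem pedalArea_eq_integral : pedalArea K =
    1 / 2 * ∫ φ in (0 : ℝ)..2 * π, (supp K φ - inner ℝ (steinerPoint K) (N φ)) ^ 2 := by
  set c := steinerPoint K with hcdef
  set q : ℝ → ℝ := fun φ => supp K φ - inner ℝ c (N φ) with hq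
  have hqpos : ∀ φ, 0 < q φ := fun φ => sub_pos.2 (hK.inner_steinerPoint_lt φ)
  have hqp : Function.Periodic q (2 * π) := fun φ => by
    simp only [hq, N_add_two_pi, supp_periodic K φ]
  set q' : ℝ → ℝ := fun φ => deriv (supp K) φ - (c 0 * -sin φ + c 1 * cos φ) with hq'
  have hd : ∀ φ, HasDerivAt q (q' φ) φ := fun φ => by
    simp only [hq, inner_N]
    exact (hK.hasDerivAt_supp φ).sub
      (((hasDerivAt_cos φ).const_mul _).add ((hasDerivAt_sin φ).const_mul _))
  have hNc : Continuous N := continuous_iff_continuousAt.2 fun φ => (hasDerivAt_N φ).continuousAt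
  have hN'c : Continuous N' :=
    continuous_iff_continuousAt.2 fun φ => (hasDerivAt_N' φ).continuousAt
  have hqc : Continuous q := continuous_iff_continuousAt.2 fun φ => (hd φ).continuousAt
  have hq'c : Continuous q' := by
    have := hK.continuous_deriv
    fun_prop
  have himg : (⋃ φ : ℝ, segment ℝ c (pedal K c φ)) =
      insert c ((fun x : ℝ × ℝ => c + x.2 • (q x.1 • N x.1)) '' starDomain) := by
    ext x
    simp only [Set.mem_iUnion, segment_eq_image', Set.mem_insert_iff, Set.mem_image, pedal,
      add_sub_cancel_left]
    constructor
    · rintro ⟨φ, t, ht, rfl⟩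
      rcases eq_or_lt_of_le ht.1 with h0 | h0
      · left; simp [← h0]
      right
      obtain ⟨ψ, hψ, h⟩ := (show Function.Periodic (fun ψ => (q ψ, N ψ)) (2 * π)
        from fun ψ => by simp only [hqp ψ, N_add_two_pi]).exists_mem_Ico two_pi_pos φ 0
      simp only [Prod.mk.injEq] at h
      rw [zero_add] at hψ
      refine ⟨(ψ, t), ⟨hψ, h0, ht.2⟩, ?_⟩
      simp only [← h.1, ← h.2]
      rfl
    · rintro (rfl | ⟨⟨φ, t⟩, ⟨-, ht⟩, rfl⟩)
      · exact ⟨0, 0, by simp, by simp⟩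
      · exact ⟨φ, t, ⟨ht.1.le, ht.2⟩, rfl⟩
  have hcr : ∀ φ, cross (q φ • N φ) (q φ • N' φ + q' φ • N φ) = q φ ^ 2 := fun φ => by
    simp [cross]
    linear_combination q φ ^ 2 * sin_sq_add_cos_sq φ
  rw [pedalArea, ← hcdef, himg, area_star (β := fun φ => q φ • N φ) c
    (fun φ => (hd φ).smul (hasDerivAt_N φ)) (by fun_prop)]
  · simp only [hcr]; rfl
  · intro φ; rw [hcr]; positivity
  · rintro ⟨φ, s⟩ ⟨hφ, hs⟩ ⟨ψ, t⟩ ⟨hψ, ht⟩ h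
    have h' : s • (q φ • N φ) = t • (q ψ • N ψ) := add_left_cancel h
    rw [smul_smul, smul_smul] at h'
    have hn : ∀ θ, ‖N θ‖ = 1 := fun θ => by
      rw [EuclideanSpace.norm_eq]; simp [Fin.sum_univ_two]
    have a1 : 0 < s * q φ := mul_pos hs.1 (hqpos φ)
    have a2 : 0 < t * q ψ := mul_pos ht.1 (hqpos ψ)
    have h2 := congrArg norm h'
    rw [norm_smul, norm_smul, hn, hn, mul_one, mul_one, norm_eq_abs, norm_eq_abs, abs_of_pos a1,
      abs_of_pos a2] at h2
    rw [h2] at h'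
    have h3 := smul_right_injective Plane a2.ne' h'
    have hφψ : φ = ψ := by
      by_contra hne
      exact N_ne_N hφ hψ hne h3
    subst hφψ
    rw [mul_right_cancel₀ (hqpos φ).ne' h2]

/-- The area in terms of the support function. -/
theorem area_eq : area K =
    1 / 2 * ((∫ φ in (0 : ℝ)..2 * π, supp K φ ^ 2) -
      ∫ φ in (0 : ℝ)..2 * π, deriv (supp K) φ ^ 2) := by
  have hpc := hK.continuous_supp
  have hqc := hK.continuous_deriv
  have hrc := hK.continuous_deriv2
  set c := steinerPoint K with hc
  -- The terms containing c are an exact derivative, as is pp'' + p'² = (pp')'. So the centre drops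
  -- out and p'' is traded for -p'².
  have h0 : ∫ φ in (0 : ℝ)..2 * π, (supp K φ * deriv (deriv (supp K)) φ + deriv (supp K) φ ^ 2 -
      (supp K φ + deriv (deriv (supp K)) φ) * (c 0 * cos φ + c 1 * sin φ)) = 0 := by
    refine integral_deriv_eq_zero (g := fun φ => supp K φ * deriv (supp K) φ -
      (c 0 * (deriv (supp K) φ * cos φ + supp K φ * sin φ) +
        c 1 * (deriv (supp K) φ * sin φ - supp K φ * cos φ))) (fun φ => ?_) (by fun_prop) ?_
    · have d1 := hK.hasDerivAt_supp φ
      have d2 := hK.hasDerivAt_deriv φ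
      have ds := hasDerivAt_sin φ
      have dc := hasDerivAt_cos φ
      refine ((d1.mul d2).sub ((((d2.mul dc).add (d1.mul ds)).const_mul (c 0)).add
        (((d2.mul ds).sub (d1.mul dc)).const_mul (c 1)))).congr_deriv ?_
      ring
    · have e1 : supp K (2 * π) = supp K 0 := by simpa using supp_periodic K 0
      have e2 : deriv (supp K) (2 * π) = deriv (supp K) 0 := by
        simpa using deriv_periodic (supp_periodic K) 0
      simp [e1, e2]
  rw [hK.area_eq_of_center hK.inner_steinerPoint_lt, ← intervalIntegral.integral_sub
    (by apply Continuous.intervalIntegrable; fun_prop)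
    (by apply Continuous.intervalIntegrable; fun_prop)]
  congr 1
  refine Eq.trans ?_ ((congrArg (_ + ·) h0).trans (add_zero _))
  simp only
  rw [← intervalIntegral.integral_add (by apply Continuous.intervalIntegrable; fun_prop)
    (by apply Continuous.intervalIntegrable; fun_prop)]
  apply intervalIntegral.integral_congr
  intro φ _
  simp only [curvRadius, inner_N]
  ring

/-- The area of the pedal curve with respect to the Steiner point. -/
theorem pedalArea_eq : pedalArea K = 1 / 2 * ((∫ φ in (0 : ℝ)..2 * π, supp K φ ^ 2) -
    1 / π * ((∫ φ in (0 : ℝ)..2 * π, supp K φ * cos φ) ^ 2 +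
      (∫ φ in (0 : ℝ)..2 * π, supp K φ * sin φ) ^ 2)) := by
  have hpc := hK.continuous_supp
  rw [hK.pedalArea_eq_integral]
  congr 1
  set a := steinerPoint K 0 with ha
  set b := steinerPoint K 1 with hb
  have e : ∀ φ, (supp K φ - inner ℝ (steinerPoint K) (N φ)) ^ 2 =
      supp K φ ^ 2 + (-2 * a) * (supp K φ * cos φ) + (-2 * b) * (supp K φ * sin φ) +
      (a ^ 2 * cos φ ^ 2 + b ^ 2 * sin φ ^ 2 + 2 * a * b * (sin φ * cos φ)) := fun φ => by
    rw [inner_N]; ring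
  simp only [e]
  have i1 : ∫ φ in (0 : ℝ)..2 * π, cos φ ^ 2 = π := by rw [integral_cos_sq]; simp
  have i2 : ∫ φ in (0 : ℝ)..2 * π, sin φ ^ 2 = π := by rw [integral_sin_sq]; simp
  have i3 : ∫ φ in (0 : ℝ)..2 * π, sin φ * cos φ = 0 := by rw [integral_sin_mul_cos₁]; simp
  rw [intervalIntegral.integral_add, intervalIntegral.integral_add, intervalIntegral.integral_add,
    intervalIntegral.integral_add, intervalIntegral.integral_add]
  · simp only [intervalIntegral.integral_const_mul, i1, i2, i3]
    have h1 := hK.steinerPoint_zero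
    have h2 := hK.steinerPoint_one
    rw [← ha] at h1
    rw [← hb] at h2
    have hπ := pi_ne_zero
    have h1' : ∫ φ in (0 : ℝ)..2 * π, supp K φ * cos φ = π * a := by rw [h1]; field_simp
    have h2' : ∫ φ in (0 : ℝ)..2 * π, supp K φ * sin φ = π * b := by rw [h2]; field_simp
    rw [h1', h2']
    field_simp
    ring
  all_goals apply Continuous.intervalIntegrable; fun_prop

/-- Cauchy's formula: the speed is p + p'', and p'' integrates to zero over a period. -/
theorem perimeter_eq : perimeter K = ∫ φ in (0 : ℝ)..2 * π, supp K φ := by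
  have hpc := hK.continuous_supp
  have hrc := hK.continuous_deriv2
  have hn : ∀ θ, ‖N' θ‖ = 1 := fun θ => by
    rw [EuclideanSpace.norm_eq]; simp [Fin.sum_univ_two]
  have e : ∀ φ, ‖deriv (boundary K) φ‖ = supp K φ + deriv (deriv (supp K)) φ := fun φ => by
    rw [(hK.hasDerivAt_boundary φ).deriv, norm_smul, hn, mul_one, norm_eq_abs,
      abs_of_pos (hK.curvRadius_pos φ)]
    rfl
  simp only [perimeter, e]
  rw [intervalIntegral.integral_add (hpc.intervalIntegrable _ _) (hrc.intervalIntegrable _ _),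
    integral_deriv_eq_zero hK.hasDerivAt_deriv hrc, add_zero]
  simpa using (deriv_periodic (supp_periodic K) 0).symm

theorem integral_supp_pos : 0 < ∫ φ in (0 : ℝ)..2 * π, supp K φ := by
  rw [← hK.perimeter_eq, perimeter]
  have hn : ∀ θ, ‖N' θ‖ = 1 := fun θ => by
    rw [EuclideanSpace.norm_eq]; simp [Fin.sum_univ_two]
  have e : ∀ φ, ‖deriv (boundary K) φ‖ = curvRadius K φ := fun φ => by
    rw [(hK.hasDerivAt_boundary φ).deriv, norm_smul, hn, mul_one, norm_eq_abs,
      abs_of_pos (hK.curvRadius_pos φ)]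
  simp only [e]
  exact intervalIntegral.intervalIntegral_pos_of_pos
    (hK.continuous_curvRadius.intervalIntegrable _ _) hK.curvRadius_pos two_pi_pos

end IsSmoothBody

/-! ### The area swept by the evolute -/

/-- The area swept by the curve `h N' - h' N`, for a `C¹` function `h`. -/
theorem hasSweptArea_of_hasDerivAt {h h' : ℝ → ℝ} (hh : ∀ x, HasDerivAt h (h' x) x)
    (hc' : Continuous h') {a b : ℝ} (hab : a < b) (hper : h a * h' a = h b * h' b) :
    HasSweptArea (fun φ => h φ • N' φ - h' φ • N φ) a b
      (1 / 2 * ((∫ x in a..b, h x ^ 2) - ∫ x in a..b, h' x ^ 2)) := by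
  have hc : Continuous h := continuous_iff_continuousAt.2 fun x => (hh x).continuousAt
  -- On a cell [s, t] the cross product of the end points equals the increment of h h', plus the
  -- integral of h² - h'², plus the integral of `D (s, t, ·)`. The increments telescope to zero; `D`
  -- is continuous and vanishes on the diagonal, so uniform continuity bounds the total error. No
  -- derivative of h' is needed.
  set D : ℝ × ℝ × ℝ → ℝ := fun y =>
    (h y.1 * h y.2.1 + h' y.1 * h' y.2.1) * cos (y.2.2 - y.1) -
    (h y.1 * h' y.2.1 - h' y.1 * h y.2.1) * sin (y.2.2 - y.1) -
    (h' y.2.1 + h' y.1) * h' y.2.2 - (h y.2.2 ^ 2 - h' y.2.2 ^ 2) with hD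
  have hDc : Continuous D := by fun_prop
  have hD0 : ∀ s, D (s, s, s) = 0 := fun s => by simp [hD]; ring
  have hcell : ∀ s t, cross (h s • N' s - h' s • N s) (h t • N' t - h' t • N t) =
      (h t * h' t - h s * h' s) + (∫ x in s..t, (h x ^ 2 - h' x ^ 2)) +
        ∫ x in s..t, D (s, t, x) := by
    intro s t
    rw [add_assoc, ← intervalIntegral.integral_add (by apply Continuous.intervalIntegrable; fun_prop)
      (by apply Continuous.intervalIntegrable; fun_prop)]
    rw [intervalIntegral.integral_eq_sub_of_hasDerivAt (f := fun x =>
      (h s * h t + h' s * h' t) * sin (x - s) + (h s * h' t - h' s * h t) * cos (x - s) -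
      (h' t + h' s) * h x) (fun x _ => ?_) (by apply Continuous.intervalIntegrable; fun_prop)]
    · simp only [sub_self, sin_zero, cos_zero, cross, PiLp.sub_apply, PiLp.smul_apply, N_zero,
        N_one, N'_zero, N'_one, smul_eq_mul, sin_sub, cos_sub]
      ring
    · have ds : HasDerivAt (fun x => sin (x - s)) (cos (x - s)) x := by
        simpa using (hasDerivAt_sin (x - s)).comp_sub_const x s
      have dc : HasDerivAt (fun x => cos (x - s)) (-sin (x - s)) x := by
        simpa using (hasDerivAt_cos (x - s)).comp_sub_const x s
      refine (((ds.const_mul (h s * h t + h' s * h' t)).add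
        (dc.const_mul (h s * h' t - h' s * h t))).sub ((hh x).const_mul _)).congr_deriv ?_
      simp only [hD]; ring
  intro ε hε
  have hε' : 0 < ε / (b - a) := div_pos hε (sub_pos.2 hab)
  have huc := (isCompact_Icc.prod (isCompact_Icc.prod isCompact_Icc) :
    IsCompact (Set.Icc a b ×ˢ Set.Icc a b ×ˢ Set.Icc a b)).uniformContinuousOn_of_continuous
      hDc.continuousOn
  rw [Metric.uniformContinuousOn_iff] at huc
  obtain ⟨δ, hδ, huc⟩ := huc _ hε'
  refine ⟨δ, hδ, fun n t ht0 htn ht => ?_⟩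
  have hmono : ∀ j ≤ n, ∀ i ≤ j, t i ≤ t j := by
    intro j
    induction j with
    | zero => intro _ i hi; rw [Nat.le_zero.1 hi]
    | succ j ih =>
      intro hj i hi
      rcases Nat.le_succ_iff.1 hi with h1 | h1
      · exact (ih (by omega) i h1).trans (ht j (by omega)).1
      · rw [h1]
  have hmem : ∀ i ≤ n, t i ∈ Set.Icc a b := fun i hi =>
    ⟨ht0 ▸ hmono i hi 0 (Nat.zero_le _), htn ▸ hmono n le_rfl i hi⟩
  have hbound : ∀ i ∈ Finset.range n, |∫ x in t i..t (i + 1), D (t i, t (i + 1), x)| ≤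
      ε / (b - a) * (t (i + 1) - t i) := by
    intro i hi
    rw [Finset.mem_range] at hi
    have h1 := ht i hi
    have m1 := hmem i hi.le
    have m2 := hmem (i + 1) hi
    have := intervalIntegral.norm_integral_le_of_norm_le_const (a := t i) (b := t (i + 1))
      (f := fun x => D (t i, t (i + 1), x)) (C := ε / (b - a)) (fun x hx => by
        rw [Set.uIoc_of_le h1.1] at hx
        have := huc (t i, t (i + 1), x) ⟨m1, m2, by linarith [m1.1, hx.1], by linarith [m2.2, hx.2]⟩
          (t i, t i, t i) ⟨m1, m1, m1⟩ (by
            simp only [Prod.dist_eq, dist_self, Real.dist_eq]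
            rw [abs_of_nonneg (sub_nonneg.2 h1.1), abs_of_pos (sub_pos.2 hx.1)]
            exact max_lt hδ (max_lt h1.2 (by linarith [hx.2])))
        rw [hD0, dist_zero_right] at this
        exact this.le)
    rwa [norm_eq_abs, abs_of_nonneg (sub_nonneg.2 h1.1)] at this
  have hsum : ∑ i ∈ Finset.range n, cross (h (t i) • N' (t i) - h' (t i) • N (t i))
      (h (t (i + 1)) • N' (t (i + 1)) - h' (t (i + 1)) • N (t (i + 1))) =
      ((∫ x in a..b, h x ^ 2) - ∫ x in a..b, h' x ^ 2) +
        ∑ i ∈ Finset.range n, ∫ x in t i..t (i + 1), D (t i, t (i + 1), x) := by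
    simp only [hcell, Finset.sum_add_distrib]
    rw [Finset.sum_range_sub (fun i => h (t i) * h' (t i)), ht0, htn, hper, sub_self, zero_add,
      intervalIntegral.sum_integral_adjacent_intervals (fun i _ => by
        apply Continuous.intervalIntegrable; fun_prop), ht0, htn,
      intervalIntegral.integral_sub (by apply Continuous.intervalIntegrable; fun_prop)
        (by apply Continuous.intervalIntegrable; fun_prop)]
  have herr : |∑ i ∈ Finset.range n, ∫ x in t i..t (i + 1), D (t i, t (i + 1), x)| ≤ ε := by
    refine (Finset.abs_sum_le_sum_abs _ _).trans ((Finset.sum_le_sum hbound).trans ?_)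
    rw [← Finset.mul_sum, Finset.sum_range_sub, ht0, htn, div_mul_cancel₀ _ (sub_pos.2 hab).ne']
  rw [hsum]
  -- The error sum is at most ε, and halving it for the triangle areas gives the strict inequality.
  have e : ∀ A B : ℝ, (A + B) / 2 - 1 / 2 * A = B / 2 := fun A B => by ring
  rw [e, abs_div, abs_two]
  linarith

theorem IsSmoothBody.hasSweptArea_evolute {K : Set Plane} (hK : IsSmoothBody K) :
    HasSweptArea (evolute K) 0 (2 * π)
      (1 / 2 * ((∫ φ in (0 : ℝ)..2 * π, deriv (supp K) φ ^ 2) -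
        ∫ φ in (0 : ℝ)..2 * π, deriv (deriv (supp K)) φ ^ 2)) := by
  have e : evolute K = fun φ => deriv (supp K) φ • N' φ - deriv (deriv (supp K)) φ • N φ := by
    funext φ
    simp only [evolute, boundary, envelope, curvRadius]
    module
  rw [e]
  have hq := deriv_periodic (supp_periodic K)
  refine hasSweptArea_of_hasDerivAt hK.hasDerivAt_deriv hK.continuous_deriv2 two_pi_pos ?_
  have e1 : deriv (supp K) (2 * π) = deriv (supp K) 0 := by simpa using hq 0
  have e2 : deriv (deriv (supp K)) (2 * π) = deriv (deriv (supp K)) 0 := by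
    simpa using deriv_periodic hq 0
  rw [e1, e2]

/-! ### Fourier coefficients of real periodic functions -/

/-- The complex Fourier coefficients of a real function on `[0, 2π]`. -/
noncomputable def fourierCoef (f : ℝ → ℝ) (n : ℤ) : ℂ :=
  fourierCoeffOn two_pi_pos (fun x => (f x : ℂ)) n

/-- The period is a variable T because `fourierCoeffOn` on [0, 2π] has period 2π - 0, while the
circle used for pointwise convergence has period 2π. -/
theorem fourier_neg_coe {T : ℝ} (hT : T = 2 * π) (n : ℤ) (x : ℝ) :
    (fourier (-n) (x : AddCircle T) : ℂ) =
      (cos (n * x) : ℂ) - Complex.I * (sin (n * x) : ℂ) := by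
  subst hT
  rw [fourier_coe_apply]
  have hπ : (π : ℂ) ≠ 0 := by exact_mod_cast pi_ne_zero
  have e : 2 * (π : ℂ) * Complex.I * ((-n : ℤ) : ℂ) * x / ((2 * π : ℝ) : ℂ) =
      ((-(n * x) : ℝ) : ℂ) * Complex.I := by
    push_cast; field_simp
  rw [e, Complex.exp_mul_I, ← Complex.ofReal_cos, ← Complex.ofReal_sin, cos_neg, sin_neg]
  push_cast; ring

theorem integral_fourier_smul {T : ℝ} (hT : T = 2 * π) {f : ℝ → ℝ} (hf : Continuous f) (n : ℤ) :
    ∫ x in (0 : ℝ)..2 * π, fourier (-n) (x : AddCircle T) • (f x : ℂ) =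
      ((∫ x in (0 : ℝ)..2 * π, f x * cos (n * x) : ℝ) : ℂ) -
        Complex.I * ((∫ x in (0 : ℝ)..2 * π, f x * sin (n * x) : ℝ) : ℂ) := by
  rw [← intervalIntegral.integral_ofReal, ← intervalIntegral.integral_ofReal,
    ← intervalIntegral.integral_const_mul, ← intervalIntegral.integral_sub
      (by apply Continuous.intervalIntegrable; fun_prop)
      (by apply Continuous.intervalIntegrable; fun_prop)]
  apply intervalIntegral.integral_congr
  intro x _
  simp only [fourier_neg_coe hT, smul_eq_mul]
  push_cast; ring

theorem fourierCoef_eq {f : ℝ → ℝ} (hf : Continuous f) (n : ℤ) :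
    fourierCoef f n = 1 / (2 * π) *
      (((∫ x in (0 : ℝ)..2 * π, f x * cos (n * x) : ℝ) : ℂ) -
        Complex.I * ((∫ x in (0 : ℝ)..2 * π, f x * sin (n * x) : ℝ) : ℂ)) := by
  rw [fourierCoef, fourierCoeffOn_eq_integral, integral_fourier_smul (sub_zero _) hf, sub_zero,
    Complex.real_smul]
  push_cast; ring

theorem norm_fourierCoef_sq {f : ℝ → ℝ} (hf : Continuous f) (n : ℤ) :
    4 * π ^ 2 * ‖fourierCoef f n‖ ^ 2 = (∫ x in (0 : ℝ)..2 * π, f x * cos (n * x)) ^ 2 +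
      (∫ x in (0 : ℝ)..2 * π, f x * sin (n * x)) ^ 2 := by
  rw [fourierCoef_eq hf]
  set a := ∫ x in (0 : ℝ)..2 * π, f x * cos (n * x)
  set b := ∫ x in (0 : ℝ)..2 * π, f x * sin (n * x)
  have e : (1 / (2 * π) * ((a : ℂ) - Complex.I * (b : ℂ)) : ℂ) =
      ((a / (2 * π) : ℝ) : ℂ) + ((-b / (2 * π) : ℝ) : ℂ) * Complex.I := by
    push_cast; ring
  rw [e, Complex.sq_norm, Complex.normSq_add_mul_I]
  have := pi_ne_zero
  field_simp
  ring

theorem hasSum_fourierCoef {f : ℝ → ℝ} (hf : Continuous f) :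
    HasSum (fun n => ‖fourierCoef f n‖ ^ 2) (1 / (2 * π) * ∫ x in (0 : ℝ)..2 * π, f x ^ 2) := by
  have hc : Continuous fun x => (f x : ℂ) := by fun_prop
  obtain ⟨C, hC⟩ := (isCompact_Icc (a := 0) (b := 2 * π)).exists_bound_of_continuousOn
    hc.continuousOn
  have hL : MemLp (fun x => (f x : ℂ)) 2 (volume.restrict (Set.Ioc 0 (2 * π))) :=
    MemLp.of_bound hc.aestronglyMeasurable C
      ((ae_restrict_iff' measurableSet_Ioc).2 (.of_forall fun x hx =>
        hC x (Set.Ioc_subset_Icc_self hx)))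
  have := hasSum_sq_fourierCoeffOn two_pi_pos hL
  simp only [sub_zero, smul_eq_mul, Complex.norm_real, norm_eq_abs, sq_abs] at this
  rw [one_div]
  exact this

theorem fourierCoef_deriv {f f' : ℝ → ℝ} (hf : ∀ x, HasDerivAt f (f' x) x) (hc : Continuous f')
    (hper : Function.Periodic f (2 * π)) (n : ℤ) :
    fourierCoef f' n = Complex.I * n * fourierCoef f n := by
  have hfc : Continuous f := continuous_iff_continuousAt.2 fun x => (hf x).continuousAt
  have e : f (2 * π) = f 0 := by simpa using hper 0
  rcases eq_or_ne n 0 with rfl | hn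
  · rw [fourierCoef_eq hc]
    simp [integral_deriv_eq_zero hf hc e.symm]
  · have := fourierCoeffOn_of_hasDerivAt two_pi_pos (f := fun x => (f x : ℂ))
      (f' := fun x => (f' x : ℂ)) hn (fun x _ => (hf x).ofReal_comp)
      (by apply Continuous.intervalIntegrable; fun_prop)
    rw [fourierCoef, fourierCoef, this, e]
    have hn' : (n : ℂ) ≠ 0 := by exact_mod_cast hn
    have hπ : (π : ℂ) ≠ 0 := by exact_mod_cast pi_ne_zero
    have hI := Complex.I_ne_zero
    push_cast
    field_simp
    ring

theorem fourierCoef_add {f g : ℝ → ℝ} (hf : Continuous f) (hg : Continuous g) (n : ℤ) :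
    fourierCoef (fun x => f x + g x) n = fourierCoef f n + fourierCoef g n := by
  rw [fourierCoef_eq hf, fourierCoef_eq hg, fourierCoef_eq (by fun_prop)]
  simp only [add_mul]
  rw [intervalIntegral.integral_add (by apply Continuous.intervalIntegrable; fun_prop)
    (by apply Continuous.intervalIntegrable; fun_prop),
    intervalIntegral.integral_add (by apply Continuous.intervalIntegrable; fun_prop)
    (by apply Continuous.intervalIntegrable; fun_prop)]
  push_cast; ring

theorem fourierCoef_const_mul {f : ℝ → ℝ} (hf : Continuous f) (c : ℝ) (n : ℤ) :
    fourierCoef (fun x => c * f x) n = c * fourierCoef f n := by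
  rw [fourierCoef_eq hf, fourierCoef_eq (by fun_prop)]
  simp only [mul_assoc, intervalIntegral.integral_const_mul]
  push_cast; ring

/-- Differentiating the cosine and the sine gives two linear relations between their n-th
coefficients. Eliminating one leaves (n² - k²) times the other equal to zero. -/
theorem fourierCoef_cos_sin {k : ℕ} {n : ℤ} (h : n ^ 2 ≠ (k : ℤ) ^ 2) :
    fourierCoef (fun x => cos (k * x)) n = 0 ∧ fourierCoef (fun x => sin (k * x)) n = 0 := by
  have dc : ∀ x : ℝ, HasDerivAt (fun x => cos (k * x)) (-k * sin (k * x)) x := fun x => by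
    refine (((hasDerivAt_id x).const_mul (k : ℝ)).cos).congr_deriv ?_
    simp; ring
  have ds : ∀ x : ℝ, HasDerivAt (fun x => sin (k * x)) (k * cos (k * x)) x := fun x => by
    refine (((hasDerivAt_id x).const_mul (k : ℝ)).sin).congr_deriv ?_
    simp; ring
  have e : ∀ x : ℝ, (k : ℝ) * (x + 2 * π) = k * x + k * (2 * π) := fun x => by ring
  have pc : Function.Periodic (fun x => cos (k * x)) (2 * π) := fun x => by
    simp only [e, cos_add_nat_mul_two_pi]
  have ps : Function.Periodic (fun x => sin (k * x)) (2 * π) := fun x => by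
    simp only [e, sin_add_nat_mul_two_pi]
  have h1 := fourierCoef_deriv dc (by fun_prop) pc n
  have h2 := fourierCoef_deriv ds (by fun_prop) ps n
  rw [fourierCoef_const_mul (by fun_prop)] at h1 h2
  set C := fourierCoef (fun x => cos (k * x)) n
  set S := fourierCoef (fun x => sin (k * x)) n
  have hne : ((n : ℂ) ^ 2 - (k : ℂ) ^ 2) ≠ 0 := by
    rw [sub_ne_zero]; exact_mod_cast h
  push_cast at h1 h2
  have hI := Complex.I_sq
  constructor
  · apply (mul_eq_zero.1 (?_ : ((n : ℂ) ^ 2 - (k : ℂ) ^ 2) * C = 0)).resolve_left hne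
    linear_combination (Complex.I * n) * h1 - (k : ℂ) * h2 + n ^ 2 * C * hI
  · apply (mul_eq_zero.1 (?_ : ((n : ℂ) ^ 2 - (k : ℂ) ^ 2) * S = 0)).resolve_left hne
    linear_combination (Complex.I * n) * h2 + (k : ℂ) * h1 + n ^ 2 * S * hI

/-! ### Degree at most three and vanishing of higher Fourier coefficients. -/

/-- Trigonometric polynomials of degree at most three. -/
def IsTrigCubic (f : ℝ → ℝ) : Prop :=
  ∃ a : Fin 4 → ℝ × ℝ, ∀ x, f x = ∑ k : Fin 4,
    ((a k).1 * cos ((k : ℕ) * x) + (a k).2 * sin ((k : ℕ) * x))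

theorem IsTrigCubic.add {f g : ℝ → ℝ} (hf : IsTrigCubic f) (hg : IsTrigCubic g) :
    IsTrigCubic fun x => f x + g x := by
  obtain ⟨a, ha⟩ := hf
  obtain ⟨b, hb⟩ := hg
  refine ⟨a + b, fun x => ?_⟩
  simp only
  rw [ha, hb, ← Finset.sum_add_distrib]
  refine Finset.sum_congr rfl fun k _ => ?_
  simp only [Pi.add_apply, Prod.fst_add, Prod.snd_add]; ring

theorem isTrigCubic_cos_sin (k : Fin 4) (a b : ℝ) :
    IsTrigCubic fun x => a * cos ((k : ℕ) * x) + b * sin ((k : ℕ) * x) := by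
  refine ⟨fun j => if j = k then (a, b) else 0, fun x => ?_⟩
  rw [Finset.sum_eq_single k]
  · simp
  · intro j _ hj; simp [hj]
  · simp

theorem isTrigCubic_const (c : ℝ) : IsTrigCubic fun _ => c := by
  simpa using isTrigCubic_cos_sin 0 c 0

theorem isTrigCubic_sum {ι : Type*} (s : Finset ι) {f : ι → ℝ → ℝ}
    (hf : ∀ i ∈ s, IsTrigCubic (f i)) : IsTrigCubic fun x => ∑ i ∈ s, f i x := by
  classical
  induction s using Finset.induction_on with
  | empty => simpa using isTrigCubic_const 0
  | insert i s hi ih =>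
    simp only [Finset.sum_insert hi]
    exact (hf i (Finset.mem_insert_self i s)).add
      (ih fun j hj => hf j (Finset.mem_insert_of_mem hj))

theorem fourierCoef_eq_zero_of_isTrigCubic {f : ℝ → ℝ} (hf : IsTrigCubic f) {n : ℤ}
    (hn : 4 ≤ |n|) : fourierCoef f n = 0 := by
  obtain ⟨a, ha⟩ := hf
  have hne : ∀ k : Fin 4, n ^ 2 ≠ ((k : ℕ) : ℤ) ^ 2 := by
    intro k h
    have h1 : (16 : ℤ) ≤ n ^ 2 := by rw [← sq_abs]; nlinarith
    have h2 : ((k : ℕ) : ℤ) ≤ 3 := by have := k.2; omega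
    have h3 : (0 : ℤ) ≤ ((k : ℕ) : ℤ) := by positivity
    nlinarith
  have key : ∀ s : Finset (Fin 4), fourierCoef (fun x => ∑ k ∈ s,
      ((a k).1 * cos ((k : ℕ) * x) + (a k).2 * sin ((k : ℕ) * x))) n = 0 := by
    intro s
    induction s using Finset.induction_on with
    | empty => simp [fourierCoef_eq (f := fun _ => 0) (by fun_prop)]
    | insert i s hi ih =>
      simp only [Finset.sum_insert hi]
      rw [fourierCoef_add (by fun_prop) (by fun_prop), ih, fourierCoef_add (by fun_prop)
        (by fun_prop), fourierCoef_const_mul (by fun_prop), fourierCoef_const_mul (by fun_prop),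
        (fourierCoef_cos_sin (hne i)).1, (fourierCoef_cos_sin (hne i)).2]
      simp
  rw [funext ha]
  exact key Finset.univ

/-- A continuous periodic function without Fourier coefficients of order at least four is a
trigonometric polynomial of degree at most three. -/
theorem isTrigCubic_of_fourierCoef {f : ℝ → ℝ} (hf : Continuous f)
    (hper : Function.Periodic f (2 * π)) (h : ∀ n : ℤ, 4 ≤ |n| → fourierCoef f n = 0) :
    IsTrigCubic f := by
  have : Fact (0 < 2 * π) := ⟨two_pi_pos⟩
  have hper' : Function.Periodic (fun x => (f x : ℂ)) (2 * π) := fun x => by simp only [hper x]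
  have hfc : Continuous fun x => (f x : ℂ) := by fun_prop
  set F : C(AddCircle (2 * π), ℂ) := ⟨hper'.lift, continuous_coinduced_dom.mpr hfc⟩ with hF
  have hFx : ∀ x : ℝ, F (x : AddCircle (2 * π)) = f x := fun x => rfl
  have hco : ∀ n, fourierCoeff F n = fourierCoef f n := fun n => by
    rw [fourierCoeff_eq_intervalIntegral _ n 0, zero_add, fourierCoef_eq hf,
      ← integral_fourier_smul rfl hf n, Complex.real_smul]
    simp only [hFx]
    push_cast; ring
  have hfin : ∀ n ∉ Finset.Icc (-3 : ℤ) 3, fourierCoeff F n = 0 := fun n hn => by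
    rw [hco]
    apply h
    rw [Finset.mem_Icc] at hn
    rcases abs_cases n with h1 | h1 <;> omega
  -- Finite support makes the coefficients summable, so the Fourier series of the continuous
  -- function converges pointwise to it and is a finite sum.
  have hs : Summable (fourierCoeff F) := summable_of_ne_finset_zero hfin
  have hterm : ∀ n ∈ Finset.Icc (-3 : ℤ) 3,
      IsTrigCubic fun x => (fourierCoeff F n * fourier n (x : AddCircle (2 * π))).re := by
    intro n hn
    rw [Finset.mem_Icc] at hn
    have e : ∀ x : ℝ, (fourierCoeff F n * fourier n (x : AddCircle (2 * π))).re =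
        (fourierCoeff F n).re * cos (n * x) - (fourierCoeff F n).im * sin (n * x) := fun x => by
      have := fourier_neg_coe (T := 2 * π) rfl (-n) x
      rw [neg_neg] at this
      rw [this]
      simp [Complex.mul_re, -Complex.ofReal_cos, -Complex.ofReal_sin]
    simp only [e]
    rcases le_total 0 n with h0 | h0
    · obtain ⟨k, rfl⟩ := Int.eq_ofNat_of_zero_le h0
      have := isTrigCubic_cos_sin ⟨k, by omega⟩ (fourierCoeff F k).re (-(fourierCoeff F k).im)
      simpa [sub_eq_add_neg] using this
    · obtain ⟨k, hk⟩ := Int.eq_ofNat_of_zero_le (neg_nonneg.2 h0)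
      obtain rfl : n = -(k : ℤ) := by omega
      have := isTrigCubic_cos_sin ⟨k, by omega⟩ (fourierCoeff F (-k)).re (fourierCoeff F (-k)).im
      simpa using this
  have hsum : ∀ x, f x = ∑ n ∈ Finset.Icc (-3 : ℤ) 3,
      (fourierCoeff F n * fourier n (x : AddCircle (2 * π))).re := fun x => by
    have h1 := has_pointwise_sum_fourier_series_of_summable hs (x : AddCircle (2 * π))
    have h2 : HasSum (fun i => fourierCoeff F i • (fourier i (x : AddCircle (2 * π)) : ℂ))
        (∑ n ∈ Finset.Icc (-3 : ℤ) 3, fourierCoeff F n • fourier n (x : AddCircle (2 * π))) :=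
      hasSum_sum_of_ne_finset_zero (fun n hn => by rw [hfin n hn, zero_smul])
    have h3 := h1.unique h2
    rw [hFx] at h3
    have h4 := congrArg Complex.re h3
    rw [Complex.ofReal_re, Complex.re_sum] at h4
    simpa only [smul_eq_mul] using h4
  rw [funext hsum]
  exact isTrigCubic_sum _ hterm

/-! ### The two sides of the inequality in terms of Fourier coefficients -/

/-- The energy of the `n`-th harmonic of the support function. -/
noncomputable def energy (K : Set Plane) (n : ℤ) : ℝ := ‖fourierCoef (supp K) n‖ ^ 2

theorem energy_nonneg (K : Set Plane) (n : ℤ) : 0 ≤ energy K n := sq_nonneg _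

theorem hasSum_of_eq {f g : ℤ → ℝ} {a b : ℝ} (h : HasSum g b) (hf : ∀ n, f n = g n)
    (hab : a = b) : HasSum f a := by
  rw [funext hf, hab]; exact h

namespace IsSmoothBody

variable {K : Set Plane} (hK : IsSmoothBody K)
include hK

theorem energy_eq (n : ℤ) : 4 * π ^ 2 * energy K n =
    (∫ x in (0 : ℝ)..2 * π, supp K x * cos (n * x)) ^ 2 +
      (∫ x in (0 : ℝ)..2 * π, supp K x * sin (n * x)) ^ 2 :=
  norm_fourierCoef_sq hK.continuous_supp n

theorem energy_neg (n : ℤ) : energy K (-n) = energy K n := by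
  have h1 := hK.energy_eq n
  have h2 := hK.energy_eq (-n)
  have e : ∀ x : ℝ, ((-n : ℤ) : ℝ) * x = -(n * x) := fun x => by push_cast; ring
  simp only [e, cos_neg, sin_neg, mul_neg, intervalIntegral.integral_neg, neg_sq] at h2
  rw [← h1] at h2
  exact mul_left_cancel₀ (by positivity) h2

theorem norm_fourierCoef_deriv_sq (n : ℤ) :
    ‖fourierCoef (deriv (supp K)) n‖ ^ 2 = (n : ℝ) ^ 2 * energy K n := by
  rw [fourierCoef_deriv hK.hasDerivAt_supp hK.continuous_deriv (supp_periodic K), norm_mul,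
    norm_mul, Complex.norm_I, one_mul, Complex.norm_intCast, mul_pow, sq_abs, energy]

theorem norm_fourierCoef_deriv2_sq (n : ℤ) :
    ‖fourierCoef (deriv (deriv (supp K))) n‖ ^ 2 = (n : ℝ) ^ 4 * energy K n := by
  rw [fourierCoef_deriv hK.hasDerivAt_deriv hK.continuous_deriv2
    (deriv_periodic (supp_periodic K)), norm_mul, norm_mul, Complex.norm_I, one_mul,
    Complex.norm_intCast, mul_pow, sq_abs, hK.norm_fourierCoef_deriv_sq]
  ring

theorem hasSum_energy :
    HasSum (energy K) (1 / (2 * π) * ∫ x in (0 : ℝ)..2 * π, supp K x ^ 2) :=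
  hasSum_fourierCoef hK.continuous_supp

theorem hasSum_sq_mul_energy : HasSum (fun n : ℤ => (n : ℝ) ^ 2 * energy K n)
    (1 / (2 * π) * ∫ x in (0 : ℝ)..2 * π, deriv (supp K) x ^ 2) := by
  simpa only [hK.norm_fourierCoef_deriv_sq] using hasSum_fourierCoef hK.continuous_deriv

theorem hasSum_pow_four_mul_energy : HasSum (fun n : ℤ => (n : ℝ) ^ 4 * energy K n)
    (1 / (2 * π) * ∫ x in (0 : ℝ)..2 * π, deriv (deriv (supp K)) x ^ 2) := by
  simpa only [hK.norm_fourierCoef_deriv2_sq] using hasSum_fourierCoef hK.continuous_deriv2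

/-- This is Wirtinger's inequality for p', from n² ≤ n⁴ on integers; it fixes the sign of F_e. -/
theorem integral_deriv_sq_le : ∫ x in (0 : ℝ)..2 * π, deriv (supp K) x ^ 2 ≤
    ∫ x in (0 : ℝ)..2 * π, deriv (deriv (supp K)) x ^ 2 := by
  have := hasSum_le (fun n : ℤ => ?_) hK.hasSum_sq_mul_energy hK.hasSum_pow_four_mul_energy
  · exact le_of_mul_le_mul_left this (by positivity)
  · apply mul_le_mul_of_nonneg_right _ (energy_nonneg K n)
    rcases eq_or_ne n 0 with rfl | hn
    · simp
    · have : (1 : ℤ) ≤ n ^ 2 := by have := sq_pos_of_ne_zero (a := n) hn; omega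
      have h : (1 : ℝ) ≤ (n : ℝ) ^ 2 := by exact_mod_cast this
      nlinarith

/-- The left-hand side `π |F_e| - Δ` of the inequality. -/
theorem hasSum_evolute_deficit {Fe : ℝ} (hFe : Fe =
      1 / 2 * ((∫ φ in (0 : ℝ)..2 * π, deriv (supp K) φ ^ 2) -
        ∫ φ in (0 : ℝ)..2 * π, deriv (deriv (supp K)) φ ^ 2)) :
    HasSum (fun n : ℤ => if 3 ≤ |n| then ((n : ℝ) ^ 2 - 1) * ((n : ℝ) ^ 2 - 4) * energy K n else 0)
      ((π * |Fe| - deficit K) / π ^ 2) := by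
  have hle := hK.integral_deriv_sq_le
  have habs : |Fe| = -Fe := abs_of_nonpos (by rw [hFe]; linarith)
  have h0 := hK.energy_eq 0
  simp only [Int.cast_zero, zero_mul, cos_zero, sin_zero, mul_one, mul_zero,
    intervalIntegral.integral_zero] at h0
  rw [← hK.perimeter_eq] at h0
  -- The weight is n⁴ - 5n² + 4 = (n² - 1)(n² - 4), with roots ±1 and ±2. The subtracted term at n =
  -- 0 is L²/π², the contribution of L² in Δ.
  have hs := (((hK.hasSum_pow_four_mul_energy).sub (hK.hasSum_sq_mul_energy.mul_left 5)).add
    (hK.hasSum_energy.mul_left 4)).sub (hasSum_ite_eq (0 : ℤ) (4 * energy K 0))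
  refine hasSum_of_eq (hs) (fun n => ?_) ?_
  · by_cases hn : 3 ≤ |n|
    · have : n ≠ 0 := by rintro rfl; simp at hn
      rw [if_pos hn, if_neg this]; ring
    · rw [if_neg hn]
      have h1 : -2 ≤ n := by rcases abs_cases n with h | h <;> omega
      have h2 : n ≤ 2 := by rcases abs_cases n with h | h <;> omega
      interval_cases n <;> norm_num <;> ring
  · have hπ := pi_ne_zero
    have hL : 4 * energy K 0 = perimeter K ^ 2 / π ^ 2 := by
      field_simp; linarith
    rw [hL, habs, hFe, deficit, hK.area_eq]
    field_simp
    ring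

/-- The right-hand side of the inequality. -/
theorem hasSum_pedalBound :
    HasSum (fun n : ℤ => if 3 ≤ |n| then (n : ℝ) ^ 2 * energy K n else 0)
      (9 / (40 * π ^ 2) * pedalBound K) := by
  have h1 := hK.energy_eq 1
  have h2 := hK.energy_eq 2
  push_cast at h1 h2
  simp only [one_mul] at h1
  have hfin : HasSum (fun n : ℤ => if n ∈ Finset.Icc (-2 : ℤ) 2 then (n : ℝ) ^ 2 * energy K n else 0)
      (∑ n ∈ Finset.Icc (-2 : ℤ) 2,
        if n ∈ Finset.Icc (-2 : ℤ) 2 then (n : ℝ) ^ 2 * energy K n else 0) :=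
    hasSum_sum_of_ne_finset_zero fun n hn => if_neg hn
  -- The part 2 e_1 is the Steiner point correction in the pedal area, and 8 e_2 is what the
  -- integral of sin³ ω contributes. The L² terms cancel since (8/9)(3/4) = 2/3.
  have hval : (∑ n ∈ Finset.Icc (-2 : ℤ) 2,
      if n ∈ Finset.Icc (-2 : ℤ) 2 then (n : ℝ) ^ 2 * energy K n else 0) =
      2 * energy K 1 + 8 * energy K 2 := by
    rw [show Finset.Icc (-2 : ℤ) 2 = {-2, -1, 0, 1, 2} by rfl]
    simp [hK.energy_neg]
    ring
  rw [hval] at hfin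
  refine hasSum_of_eq (hK.hasSum_sq_mul_energy.sub hfin) (fun n => ?_) ?_
  · by_cases hn : 3 ≤ |n|
    · rw [if_pos hn, if_neg, sub_zero]
      rw [Finset.mem_Icc]
      rcases abs_cases n with h | h <;> omega
    · rw [if_neg hn, if_pos, sub_self]
      rw [Finset.mem_Icc]
      rcases abs_cases n with h | h <;> constructor <;> omega
  · have hπ := pi_ne_zero
    rw [pedalBound, hK.pedalArea_eq, hK.area_eq, hK.integral_sin_visualAngle_cubed.2,
      hK.perimeter_eq, ← h1, ← h2]
    field_simp
    ring

/-- The inequality, its sign, and the case of equality in terms of harmonics. -/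
theorem pedalBound_spec {Fe : ℝ} (hFe : Fe =
      1 / 2 * ((∫ φ in (0 : ℝ)..2 * π, deriv (supp K) φ ^ 2) -
        ∫ φ in (0 : ℝ)..2 * π, deriv (deriv (supp K)) φ ^ 2)) :
    pedalBound K ≤ π * |Fe| - deficit K ∧
      (π * |Fe| - deficit K ≠ 0 → 0 < pedalBound K) ∧
      (π * |Fe| - deficit K = 0 → pedalBound K = 0) ∧
      (π * |Fe| - deficit K = pedalBound K ↔ ∀ n : ℤ, 4 ≤ |n| → energy K n = 0) := by
  have hX := hK.hasSum_evolute_deficit hFe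
  have hY := hK.hasSum_pedalBound
  have hπ : 0 < π ^ 2 := by positivity
  set X := π * |Fe| - deficit K
  set Y := pedalBound K
  have hsq : ∀ {m n : ℤ}, 0 ≤ m → m ≤ |n| → ((m : ℝ)) ^ 2 ≤ (n : ℝ) ^ 2 := fun {m n} h0 h => by
    have : m ^ 2 ≤ n ^ 2 := by rw [← sq_abs n]; exact pow_le_pow_left₀ h0 h 2
    exact_mod_cast this
  have hY0 : ∀ n : ℤ, 0 ≤ if 3 ≤ |n| then (n : ℝ) ^ 2 * energy K n else 0 := fun n => by
    split_ifs
    · exact mul_nonneg (sq_nonneg _) (energy_nonneg K n)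
    · exact le_rfl
  have hX0 : ∀ n : ℤ, 0 ≤
      if 3 ≤ |n| then ((n : ℝ) ^ 2 - 1) * ((n : ℝ) ^ 2 - 4) * energy K n else 0 := fun n => by
    split_ifs with hn
    · have := hsq (by norm_num) hn
      push_cast at this
      exact mul_nonneg (mul_nonneg (by linarith) (by linarith)) (energy_nonneg K n)
    · exact le_rfl
  -- The constant 40/9 is the ratio of (n² - 1)(n² - 4) to n² at |n| = 3, so the difference of
  -- weights has the factor n² - 9 and is positive for |n| ≥ 4.
  have hZ : HasSum (fun n : ℤ =>
      if 3 ≤ |n| then ((n : ℝ) ^ 2 - 9) * ((n : ℝ) ^ 2 - 4 / 9) * energy K n else 0)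
      ((X - Y) / π ^ 2) := by
    refine hasSum_of_eq (hX.sub (hY.mul_left (40 / 9))) (fun n => ?_) ?_
    · split_ifs <;> ring
    · field_simp
  have hZ0 : ∀ n : ℤ, 0 ≤
      if 3 ≤ |n| then ((n : ℝ) ^ 2 - 9) * ((n : ℝ) ^ 2 - 4 / 9) * energy K n else 0 := fun n => by
    split_ifs with hn
    · have := hsq (by norm_num) hn
      push_cast at this
      exact mul_nonneg (mul_nonneg (by linarith) (by linarith)) (energy_nonneg K n)
    · exact le_rfl
  -- Both sides have strictly positive weights for |n| ≥ 3, so they vanish for the same bodies; this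
  -- gives both sign statements.
  have hXzero : X = 0 ↔ ∀ n : ℤ, 3 ≤ |n| → energy K n = 0 := by
    constructor
    · intro h n hn
      rw [h, zero_div, hasSum_zero_iff_of_nonneg hX0] at hX
      have h1 := congrFun hX n
      simp only [if_pos hn, Pi.zero_apply] at h1
      have := hsq (by norm_num) hn
      push_cast at this
      exact (mul_eq_zero.1 h1).resolve_left (mul_ne_zero (by linarith) (by linarith))
    · intro h
      have h0 : (fun n : ℤ => if 3 ≤ |n| then
          ((n : ℝ) ^ 2 - 1) * ((n : ℝ) ^ 2 - 4) * energy K n else 0) = fun _ => 0 := by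
        funext n
        split_ifs with hn
        · rw [h n hn, mul_zero]
        · rfl
      rw [h0] at hX
      have := hX.unique hasSum_zero
      rwa [div_eq_zero_iff, or_iff_left hπ.ne'] at this
  have hc : 0 < 9 / (40 * π ^ 2) := by positivity
  have hYzero : Y = 0 ↔ ∀ n : ℤ, 3 ≤ |n| → energy K n = 0 := by
    constructor
    · intro h n hn
      rw [h, mul_zero, hasSum_zero_iff_of_nonneg hY0] at hY
      have h1 := congrFun hY n
      simp only [if_pos hn, Pi.zero_apply] at h1
      have := hsq (by norm_num) hn
      push_cast at this
      exact (mul_eq_zero.1 h1).resolve_left (by linarith)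
    · intro h
      have h0 : (fun n : ℤ => if 3 ≤ |n| then (n : ℝ) ^ 2 * energy K n else 0) = fun _ => 0 := by
        funext n
        split_ifs with hn
        · rw [h n hn, mul_zero]
        · rfl
      rw [h0] at hY
      have := hY.unique hasSum_zero
      exact (mul_eq_zero.1 this).resolve_left hc.ne'
  have hYnonneg : 0 ≤ Y := nonneg_of_mul_nonneg_right (hY.nonneg hY0) hc
  refine ⟨?_, fun h => lt_of_le_of_ne hYnonneg fun h0 => h (hXzero.2 (hYzero.1 h0.symm)),
    fun h => hYzero.2 (hXzero.1 h), ?_, ?_⟩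
  · have := hZ.nonneg hZ0
    rw [le_div_iff₀ hπ] at this
    linarith
  · intro h n hn
    rw [h, sub_self, zero_div, hasSum_zero_iff_of_nonneg hZ0] at hZ
    have h1 := congrFun hZ n
    simp only [if_pos (show 3 ≤ |n| by omega), Pi.zero_apply] at h1
    have := hsq (by norm_num) hn
    push_cast at this
    exact (mul_eq_zero.1 h1).resolve_left (mul_ne_zero (by linarith) (by linarith))
  · intro h
    have h0 : (fun n : ℤ => if 3 ≤ |n| then
        ((n : ℝ) ^ 2 - 9) * ((n : ℝ) ^ 2 - 4 / 9) * energy K n else 0) = fun _ => 0 := by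
      funext n
      split_ifs with hn
      · rcases eq_or_lt_of_le hn with h3 | h3
        · have : (n : ℝ) ^ 2 = 9 := by
            have : n ^ 2 = 9 := by rw [← sq_abs, ← h3]; norm_num
            exact_mod_cast this
          rw [this]; ring
        · rw [h n h3, mul_zero]
      · rfl
    rw [h0] at hZ
    have := hZ.unique hasSum_zero
    rw [div_eq_zero_iff, or_iff_left hπ.ne'] at this
    linarith

theorem isTrigCubic_iff : IsTrigCubic (supp K) ↔ ∀ n : ℤ, 4 ≤ |n| → energy K n = 0 := by
  constructor
  · intro h n hn
    rw [energy, fourierCoef_eq_zero_of_isTrigCubic h hn]; simp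
  · intro h
    refine isTrigCubic_of_fourierCoef hK.continuous_supp (supp_periodic K) fun n hn => ?_
    have := h n hn
    rwa [energy, sq_eq_zero_iff, norm_eq_zero] at this

end IsSmoothBody

/-! ### Disks and hypocycloids -/

theorem supp_closedBall (c : Plane) {ρ : ℝ} (hρ : 0 ≤ ρ) (φ : ℝ) :
    supp (Metric.closedBall c ρ) φ = inner ℝ c (N φ) + ρ := by
  have hn : ‖N φ‖ = 1 := by rw [EuclideanSpace.norm_eq]; simp [Fin.sum_univ_two]
  have hNN : inner ℝ (N φ) (N φ) = (1 : ℝ) := by rw [real_inner_self_eq_norm_sq, hn, one_pow]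
  refine IsGreatest.csSup_eq ⟨⟨c + ρ • N φ, ?_, ?_⟩, ?_⟩
  · rw [mem_closedBall_iff_norm, add_sub_cancel_left, norm_smul, hn, mul_one, norm_eq_abs,
      abs_of_nonneg hρ]
  · simp only [inner_add_left, inner_smul_left, hNN, conj_trivial, mul_one]
  · rintro _ ⟨x, hx, rfl⟩
    rw [mem_closedBall_iff_norm] at hx
    have h1 := real_inner_le_norm (x - c) (N φ)
    rw [hn, mul_one, inner_sub_left] at h1
    simp only
    linarith

theorem isTrigCubic_inner (v : Plane) : IsTrigCubic fun φ => inner ℝ v (N φ) := by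
  simpa [inner_N] using isTrigCubic_cos_sin 1 (v 0) (v 1)

theorem IsDiskSupport.isTrigCubic {f : ℝ → ℝ} (hf : IsDiskSupport f) : IsTrigCubic f := by
  obtain ⟨c, ρ, hρ, rfl⟩ := hf
  rw [funext (supp_closedBall c hρ.le)]
  exact (isTrigCubic_inner c).add (isTrigCubic_const ρ)

theorem inner_envelope (f : ℝ → ℝ) (θ : ℝ) : inner ℝ (envelope f θ) (N θ) = f θ := by
  simp only [inner_N, envelope, PiLp.add_apply, PiLp.smul_apply, N_zero, N_one, N'_zero, N'_one,
    smul_eq_mul]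
  linear_combination f θ * sin_sq_add_cos_sq θ

theorem inner_rotate (α : ℝ) (x : Plane) (t : ℝ) :
    inner ℝ (rotate α x) (N (t + α)) = inner ℝ x (N t) := by
  simp only [inner_N, rotate, Matrix.cons_val_zero, Matrix.cons_val_one,
    cos_add, sin_add]
  linear_combination (x 0 * cos t + x 1 * sin t) * sin_sq_add_cos_sq α

theorem inner_astroid (r t : ℝ) : inner ℝ (hypocycloid 4 r t) (N t) = 2 * r * sin (2 * t) := by
  have h1 : ((4 : ℕ) - 1 : ℝ) * t = 2 * t + t := by push_cast; ring
  simp only [inner_N, hypocycloid, Matrix.cons_val_zero, Matrix.cons_val_one, h1,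
    sin_add, cos_add]
  push_cast
  linear_combination (-(r * sin (2 * t))) * sin_sq_add_cos_sq t - 3 * r * sin_two_mul t

/-- Pairing a point of an envelope with its normal recovers the generalized support function. The
normal angle is half the rolling parameter, hence the argument 2s. -/
theorem inner_steinerCurve (r s : ℝ) :
    inner ℝ (hypocycloid 3 r (2 * s)) (N s) = r * sin (3 * s) := by
  have h1 : ((3 : ℕ) - 1 : ℝ) * (2 * s) = 3 * s + s := by push_cast; ring
  have h2 : 2 * s = 3 * s - s := by ring
  simp only [inner_N, hypocycloid, Matrix.cons_val_zero, Matrix.cons_val_one, h1]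
  rw [h2]
  simp only [sin_add, cos_add, sin_sub, cos_sub]
  push_cast
  linear_combination (r * sin (3 * s)) * sin_sq_add_cos_sq s

theorem isTrigCubic_sin_sub (k : Fin 4) (r α : ℝ) :
    IsTrigCubic fun θ => r * sin ((k : ℕ) * (θ - α)) := by
  have e : ∀ θ : ℝ, r * sin ((k : ℕ) * (θ - α)) =
      (-(r * sin ((k : ℕ) * α))) * cos ((k : ℕ) * θ) + r * cos ((k : ℕ) * α) * sin ((k : ℕ) * θ) :=
    fun θ => by rw [mul_sub, sin_sub]; ring
  simp only [e]
  exact isTrigCubic_cos_sin k _ _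

/-- The generalized support function of an astroid is `2 r sin (2 (θ - α)) + ⟪v, N θ⟫`. -/
theorem IsHypocycloidSupport.isTrigCubic_astroid {f : ℝ → ℝ} (hf : IsHypocycloidSupport 4 f) :
    IsTrigCubic f := by
  obtain ⟨-, r, -, α, v, h⟩ := hf
  have e : ∀ θ, f θ = 2 * r * sin ((((2 : Fin 4) : ℕ) : ℝ) * (θ - α)) + inner ℝ v (N θ) := by
    intro θ
    have h1 := h (θ - α)
    have e1 : ((4 : ℕ) - 2 : ℝ) / 2 * (θ - α) + α = θ := by push_cast; ring
    rw [e1] at h1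
    rw [← inner_envelope f θ, h1, inner_add_left]
    congr 1
    have := inner_rotate α (hypocycloid 4 r (θ - α)) (θ - α)
    rw [sub_add_cancel] at this
    rw [this, inner_astroid]
    norm_num
  rw [funext e]
  exact (isTrigCubic_sin_sub 2 (2 * r) α).add (isTrigCubic_inner v)

/-- The generalized support function of a Steiner curve is `r sin (3 (θ - α)) + ⟪v, N θ⟫`. -/
theorem IsHypocycloidSupport.isTrigCubic_steinerCurve {f : ℝ → ℝ} (hf : IsHypocycloidSupport 3 f) :
    IsTrigCubic f := by
  obtain ⟨-, r, -, α, v, h⟩ := hf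
  have e : ∀ θ, f θ = r * sin ((((3 : Fin 4) : ℕ) : ℝ) * (θ - α)) + inner ℝ v (N θ) := by
    intro θ
    have h1 := h (2 * (θ - α))
    have e1 : ((3 : ℕ) - 2 : ℝ) / 2 * (2 * (θ - α)) + α = θ := by push_cast; ring
    rw [e1] at h1
    rw [← inner_envelope f θ, h1, inner_add_left]
    congr 1
    have := inner_rotate α (hypocycloid 3 r (2 * (θ - α))) (θ - α)
    rw [sub_add_cancel] at this
    rw [this, inner_steinerCurve]
    norm_num
  rw [funext e]
  exact (isTrigCubic_sin_sub 3 r α).add (isTrigCubic_inner v)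

theorem IsParallelHypocycloidSupport.isTrigCubic {k : ℕ} (hk : k = 4 ∨ k = 3) {f : ℝ → ℝ}
    (hf : IsParallelHypocycloidSupport k f) : IsTrigCubic f := by
  obtain ⟨g, d, hg, h⟩ := hf
  rw [funext h]
  rcases hk with rfl | rfl
  · exact hg.isTrigCubic_astroid.add (isTrigCubic_const d)
  · exact hg.isTrigCubic_steinerCurve.add (isTrigCubic_const d)

theorem IsBasicSupport.isTrigCubic {f : ℝ → ℝ} (hf : IsBasicSupport f) : IsTrigCubic f := by
  rcases hf with h | h | h
  · exact h.isTrigCubic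
  · exact h.isTrigCubic (.inl rfl)
  · exact h.isTrigCubic (.inr rfl)

theorem hasDerivAt_sin_mul_sub (r k α θ : ℝ) :
    HasDerivAt (fun θ => r * sin (k * (θ - α))) (r * (k * cos (k * (θ - α)))) θ := by
  refine (((((hasDerivAt_id θ).sub_const α).const_mul k).sin).const_mul r).congr_deriv ?_
  simp only [id, mul_one]; ring

theorem isHypocycloidSupport_astroid {r : ℝ} (hr : 0 < r) (α : ℝ) :
    IsHypocycloidSupport 4 fun θ => 2 * r * sin (2 * (θ - α)) := by
  refine ⟨by fun_prop, r, hr, α, 0, fun t => ?_⟩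
  have e1 : ((4 : ℕ) - 2 : ℝ) / 2 * t + α = t + α := by push_cast; ring
  have h1 : ((4 : ℕ) - 1 : ℝ) * t = 2 * t + t := by push_cast; ring
  -- With 3t = 2t + t and t = 2t - t, both coordinates become polynomials in the sines and cosines
  -- of 2t, t and α.
  have h2 : sin t = sin (2 * t - t) := by congr 1; ring
  have h3 : cos t = cos (2 * t - t) := by congr 1; ring
  rw [sin_sub] at h2
  rw [cos_sub] at h3
  rw [e1, add_zero]
  apply plane_ext
  · simp only [envelope, (hasDerivAt_sin_mul_sub (2 * r) 2 α (t + α)).deriv, add_sub_cancel_right,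
      PiLp.add_apply, PiLp.smul_apply, N_zero, N'_zero, smul_eq_mul, rotate, hypocycloid,
      PiLp.toLp_apply, Matrix.cons_val_zero, Matrix.cons_val_one, h1]
    rw [cos_add, sin_add, sin_add, cos_add]
    push_cast
    linear_combination (-3 * r * cos α) * h2 + 3 * r * sin α * h3
  · simp only [envelope, (hasDerivAt_sin_mul_sub (2 * r) 2 α (t + α)).deriv, add_sub_cancel_right,
      PiLp.add_apply, PiLp.smul_apply, N_one, N'_one, smul_eq_mul, rotate, hypocycloid,
      PiLp.toLp_apply, Matrix.cons_val_zero, Matrix.cons_val_one, h1]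
    rw [cos_add, sin_add, sin_add, cos_add]
    push_cast
    linear_combination (-3 * r * sin α) * h2 - 3 * r * cos α * h3

theorem isHypocycloidSupport_steinerCurve {r : ℝ} (hr : 0 < r) (α : ℝ) :
    IsHypocycloidSupport 3 fun θ => r * sin (3 * (θ - α)) := by
  refine ⟨by fun_prop, r, hr, α, 0, fun t => ?_⟩
  obtain ⟨s, rfl⟩ : ∃ s, t = 2 * s := ⟨t / 2, by ring⟩
  have e1 : ((3 : ℕ) - 2 : ℝ) / 2 * (2 * s) + α = s + α := by push_cast; ring
  have h1 : ((3 : ℕ) - 1 : ℝ) * (2 * s) = 3 * s + s := by push_cast; ring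
  have h2 : 2 * s = 3 * s - s := by ring
  rw [e1, add_zero]
  apply plane_ext
  · simp only [envelope, (hasDerivAt_sin_mul_sub r 3 α (s + α)).deriv, add_sub_cancel_right,
      PiLp.add_apply, PiLp.smul_apply, N_zero, N'_zero, smul_eq_mul, rotate, hypocycloid,
      PiLp.toLp_apply, Matrix.cons_val_zero, Matrix.cons_val_one, h1]
    rw [h2]
    simp only [cos_add, sin_add, sin_sub, cos_sub]
    push_cast
    ring
  · simp only [envelope, (hasDerivAt_sin_mul_sub r 3 α (s + α)).deriv, add_sub_cancel_right,
      PiLp.add_apply, PiLp.smul_apply, N_one, N'_one, smul_eq_mul, rotate, hypocycloid,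
      PiLp.toLp_apply, Matrix.cons_val_zero, Matrix.cons_val_one, h1]
    rw [h2]
    simp only [cos_add, sin_add, sin_sub, cos_sub]
    push_cast
    ring

/-- The amplitude-phase form of a harmonic. -/
theorem exists_amplitude_phase {b c k : ℝ} (hk : k ≠ 0) (h : b ≠ 0 ∨ c ≠ 0) :
    ∃ R > 0, ∃ α, ∀ θ, b * cos (k * θ) + c * sin (k * θ) = R * sin (k * (θ - α)) := by
  obtain ⟨ψ, hψ⟩ := exists_eq_smul_N (!₂[c, -b] : Plane)
  set R := ‖(!₂[c, -b] : Plane)‖ with hR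
  have h0 : c = R * cos ψ := congrFun (congrArg WithLp.ofLp hψ) 0
  have h1 : -b = R * sin ψ := congrFun (congrArg WithLp.ofLp hψ) 1
  refine ⟨R, lt_of_le_of_ne (norm_nonneg _) fun hz => ?_, ψ / k, fun θ => ?_⟩
  · rw [← hz] at h0 h1
    simp at h0 h1
    tauto
  · rw [mul_sub, mul_div_cancel₀ _ hk, sin_sub]
    linear_combination sin (k * θ) * h0 - cos (k * θ) * h1

/-! ### Decomposition of trigonometric polynomials into basic curves. -/

/-- Sums of finitely many generalized support functions of circles and of curves parallel to
astroids or to Steiner curves. -/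
def IsSumOfBasic (f : ℝ → ℝ) : Prop :=
  ∃ (n : ℕ) (F : Fin n → ℝ → ℝ), (∀ i, IsBasicSupport (F i)) ∧ ∀ φ, f φ = ∑ i, F i φ

theorem IsBasicSupport.isSumOfBasic {f : ℝ → ℝ} (hf : IsBasicSupport f) : IsSumOfBasic f :=
  ⟨1, fun _ => f, fun _ => hf, fun φ => by simp⟩

theorem IsSumOfBasic.add {f g : ℝ → ℝ} (hf : IsBasicSupport f) (hg : IsSumOfBasic g) :
    IsSumOfBasic fun φ => f φ + g φ := by
  obtain ⟨n, F, hF, h⟩ := hg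
  refine ⟨n + 1, Fin.cons f F, fun i => ?_, fun φ => ?_⟩
  · refine Fin.cases ?_ (fun j => ?_) i
    · exact hf
    · exact hF j
  · simp [Fin.sum_univ_succ, h]

/-- A hypocycloid has r > 0, so a vanishing harmonic contributes no summand. Otherwise amplitude R
corresponds to an astroid with r = R/2. -/
theorem IsSumOfBasic.add_astroid {f : ℝ → ℝ} (hf : IsSumOfBasic f) (b c : ℝ) :
    IsSumOfBasic fun φ => (b * cos (2 * φ) + c * sin (2 * φ)) + f φ := by
  by_cases h : b ≠ 0 ∨ c ≠ 0
  · obtain ⟨R, hR, α, e⟩ := exists_amplitude_phase two_ne_zero h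
    have hb : IsBasicSupport fun θ => R * sin (2 * (θ - α)) := by
      have := isHypocycloidSupport_astroid (half_pos hR) α
      rw [mul_div_cancel₀ R two_ne_zero] at this
      exact .inr (.inl ⟨_, 0, this, fun _ => by simp⟩)
    simp only [e]
    exact IsSumOfBasic.add hb hf
  · push Not at h
    simpa [h.1, h.2] using hf

theorem IsSumOfBasic.add_steinerCurve {f : ℝ → ℝ} (hf : IsSumOfBasic f) (b c : ℝ) :
    IsSumOfBasic fun φ => (b * cos (3 * φ) + c * sin (3 * φ)) + f φ := by
  by_cases h : b ≠ 0 ∨ c ≠ 0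
  · obtain ⟨R, hR, α, e⟩ := exists_amplitude_phase three_ne_zero h
    have hb : IsBasicSupport fun θ => R * sin (3 * (θ - α)) :=
      .inr (.inr ⟨_, 0, isHypocycloidSupport_steinerCurve hR α, fun _ => by simp⟩)
    simp only [e]
    exact IsSumOfBasic.add hb hf
  · push Not at h
    simpa [h.1, h.2] using hf

namespace IsSmoothBody

variable {K : Set Plane} (hK : IsSmoothBody K)
include hK

/-- Orders 0 and 1 are the support function of a disk whose radius is the mean of `p`, positive
because the perimeter is. The disk absorbs the constant, so orders 2 and 3 need only the
hypocycloids themselves. -/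
theorem isMinkowskiSumOfBasic (h : IsTrigCubic (supp K)) : IsMinkowskiSumOfBasic K := by
  obtain ⟨a, ha⟩ := h
  simp only [Fin.sum_univ_four, Fin.val_zero, Fin.val_one, Fin.val_two,
    show ((3 : Fin 4) : ℕ) = 3 from rfl, Nat.cast_zero, Nat.cast_one, Nat.cast_ofNat, zero_mul,
    cos_zero, sin_zero, mul_one, mul_zero, add_zero, one_mul] at ha
  have hI : ∀ k : ℕ, k ≠ 0 → ∀ b c : ℝ,
      ∫ x in (0 : ℝ)..2 * π, (b * cos (k * x) + c * sin (k * x)) = 0 := by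
    intro k hk b c
    have hk' : (k : ℝ) ≠ 0 := by exact_mod_cast hk
    refine integral_deriv_eq_zero (g := fun x => b * (sin (k * x) / k) - c * (cos (k * x) / k))
      (fun x => ?_) (by fun_prop) ?_
    · have d := (hasDerivAt_id x).const_mul (k : ℝ)
      refine (((d.sin.div_const (k : ℝ)).const_mul b).sub
        ((d.cos.div_const (k : ℝ)).const_mul c)).congr_deriv ?_
      simp; field_simp; ring
    · have e1 : sin (k * (2 * π)) = 0 := by
        simpa using sin_add_nat_mul_two_pi 0 k
      simp [e1, cos_nat_mul_two_pi]
  have hpos : 0 < (a 0).1 := by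
    have h1 := hK.integral_supp_pos
    have i1 := hI 1 one_ne_zero (a 1).1 (a 1).2
    have i2 := hI 2 two_ne_zero (a 2).1 (a 2).2
    have i3 := hI 3 three_ne_zero (a 3).1 (a 3).2
    push_cast at i1 i2 i3
    simp only [one_mul] at i1
    simp only [ha] at h1
    rw [intervalIntegral.integral_add, intervalIntegral.integral_add,
      intervalIntegral.integral_add, i1, i2, i3] at h1
    · simp at h1
      have := pi_pos
      nlinarith
    all_goals apply Continuous.intervalIntegrable; fun_prop
  have hdisk : IsBasicSupport (supp (Metric.closedBall (!₂[(a 1).1, (a 1).2] : Plane) (a 0).1)) :=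
    .inl ⟨_, _, hpos, rfl⟩
  have := (hdisk.isSumOfBasic.add_astroid (a 2).1 (a 2).2).add_steinerCurve (a 3).1 (a 3).2
  obtain ⟨n, F, hF, h⟩ := this
  refine ⟨n, F, hF, fun φ => ?_⟩
  rw [← h φ]
  simp only
  rw [ha, supp_closedBall _ hpos.le, inner_N]
  simp
  ring

/-- The Minkowski sums already exhaust the trigonometric polynomials; the other two alternatives
matter only for the converse, where each generalized support function has degree at most three. -/
theorem isTrigCubic_iff_shape : IsTrigCubic (supp K) ↔
    IsDiskOrParallelAstroid K ∨ IsParallelSteinerCurve K ∨ IsMinkowskiSumOfBasic K := by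
  refine ⟨fun h => .inr (.inr (hK.isMinkowskiSumOfBasic h)), ?_⟩
  rintro ((⟨c, ρ, hρ, h⟩ | h) | h | ⟨n, f, hf, h⟩)
  · exact IsDiskSupport.isTrigCubic ⟨c, ρ, hρ, by rw [h]⟩
  · exact h.isTrigCubic (.inl rfl)
  · exact IsParallelHypocycloidSupport.isTrigCubic (.inr rfl) h
  · rw [funext h]
    exact isTrigCubic_sum _ fun i _ => (hf i).isTrigCubic

end IsSmoothBody

end Hurwitz

theorem mainTheorem5 (K : Set Hurwitz.Plane) (hne : K.Nonempty) (hcpt : IsCompact K)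
    (hconv : Convex ℝ K) (hC2 : ContDiff ℝ 2 (Hurwitz.supp K))
    (hpos : ∀ φ : ℝ, 0 < Hurwitz.curvRadius K φ) :
    MeasureTheory.IntegrableOn (fun P => Real.sin (Hurwitz.visualAngle K P) ^ 3) Kᶜ ∧
    ∃ Fe : ℝ, Hurwitz.HasSweptArea (Hurwitz.evolute K) 0 (2 * Real.pi) Fe ∧
      Hurwitz.pedalBound K ≤ Real.pi * |Fe| - Hurwitz.deficit K ∧
      (Real.pi * |Fe| - Hurwitz.deficit K ≠ 0 → 0 < Hurwitz.pedalBound K) ∧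
      (Real.pi * |Fe| - Hurwitz.deficit K = 0 → Hurwitz.pedalBound K = 0) ∧
      (Real.pi * |Fe| - Hurwitz.deficit K = Hurwitz.pedalBound K ↔
        Hurwitz.IsDiskOrParallelAstroid K ∨ Hurwitz.IsParallelSteinerCurve K ∨
          Hurwitz.IsMinkowskiSumOfBasic K) := by
  have hK : Hurwitz.IsSmoothBody K := ⟨hne, hcpt, hconv, hC2, hpos⟩
  -- Here `rfl` leaves F_e to be the explicit value in `hasSweptArea_evolute`.
  obtain ⟨h1, h2, h3, h4⟩ := hK.pedalBound_spec rfl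
  exact ⟨hK.integral_sin_visualAngle_cubed.1, _, hK.hasSweptArea_evolute, h1, h2, h3,
    h4.trans (hK.isTrigCubic_iff.symm.trans hK.isTrigCubic_iff_shape)⟩
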